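/- Setting. Let $\mathcal M=(\mathcal S,\mathcal A,P,r,\gamma,\rho)$ be an episodic Markov decision process with finite horizon $H\ge 1$, rewards $r:\mathcal S\times\mathcal A\to[-R,R]$ ($R>0$), discount factor $\gamma\in(0,1)$ and initial state distribution $\rho$. Let $\pi_\theta(a\,|\,s)>0$, $\theta\in\mathbb R^d$, be a family of policy densities with respect to a $\sigma$-finite reference measure on $\mathcal A$. A trajectory $\tau=(s_h,a_h)_{h<H}\sim p(\cdot\,|\,\theta)$ has $s_0\sim\rho$, $a_h\sim\pi_\theta(\cdot\,|\,s_h)$, $s_{h+1}\sim P(\cdot\,|\,s_h,a_h)$. Let $V^{\pi_\theta}(s)$ be the expected discounted return $\mathbb E\big[\sum_{h<H}\gamma^h r(s_h,a_h)\big]$ from $s_0=s$, $V(\theta)=\mathbb E_{s\sim\rho}[V^{\pi_\theta}(s)]$ and $V^*=\sup_{\theta\in\mathbb R^d}V(\theta)$. With $Z_{\theta,h}=\sum_{z\le h}\nabla_\theta\log\pi_\theta(a_z\,|\,s_z)$ and $\omega_{0:h}(\tau\,|\,\theta_2,\theta_1)=\prod_{j\le h}\pi_{\theta_1}(a_j\,|\,s_j)/\pi_{\theta_2}(a_j\,|\,s_j)$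 put $$g(\tau\,|\,\theta)=\sum_{h<H}\gamma^h r(s_h,a_h)Z_{\theta,h},\qquad g^{\omega_{\theta_2}}(\tau\,|\,\theta_1)=\sum_{h<H}\omega_{0:h}(\tau\,|\,\theta_2,\theta_1)\,\gamma^h r(s_h,a_h)Z_{\theta_1,h}.$$ PAGE-PG with batch sizes $N,B\ge1$, step size $\eta>0$ and switching probability $p\in(0,1]$ starts from a fixed $\theta_0$ and $v_0=\frac1N\sum_{i\le N}g(\tau_i\,|\,\theta_0)$ with $\tau_i\sim p(\cdot\,|\,\theta_0)$ independent. Then $\theta_{t+1}=\theta_t+\eta v_t$ and, with fresh independent trajectories $\tau_i\sim p(\cdot\,|\,\theta_{t+1})$, $v_{t+1}=\frac1N\sum_{i\le N}g(\tau_i\,|\,\theta_{t+1})$ with probability $p$ and $v_{t+1}=\frac1B\sum_{i\le B}g(\tau_i\,|\,\theta_{t+1})+v_t-\frac1B\sum_{i\le B}g^{\omega_{\theta_{t+1}}}(\tau_i\,|\,\theta_t)$ with probability $1-p$. Assumptions. There are constants $G,M,\sigma,W>0$ such that for all $s,a,\theta,\theta_a,\theta_b$: $\|\nabla_\theta\log\pi_\theta(a\,|\,s)\|\le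 G$; $\pi_\theta(a\,|\,s)$ is twice differentiable in $\theta$ and $\|\nabla^2_\theta\log\pi_\theta(a\,|\,s)\|\le M$; $\mathrm{Var}_{\tau\sim p(\cdot|\theta)}(g(\tau\,|\,\theta))\le\sigma^2$; and $\mathrm{Var}_{\tau\sim p(\cdot|\theta_b)}\big(p(\tau\,|\,\theta_a)/p(\tau\,|\,\theta_b)\big)\le W$. Let $L=\frac{MR}{(1-\gamma)^2}+\frac{2G^2R}{(1-\gamma)^3}$, $C_\omega=\frac{24RG^2(2G^2+M)(W+1)\gamma}{(1-\gamma)^5}$, $C=2(L^2+C_\omega)$, and suppose $$\eta^2\le\min\Big\{\frac{p}{1-p}\cdot\frac{B}{2C},\ \frac1{4L^2}\Big\}$$ (the first term being $+\infty$ if $p=1$). Corollary. Let $T\ge1$ and $\lambda>0$, and let $\Theta\subseteq\mathbb R^d$ be a set that contains each of the iterates $\theta_0,\dots,\theta_{T-1}$ almost surely (for example $\Theta=\mathbb R^d$). Suppose that the objective is gradient dominated on $\Theta$: $V^*-V(\theta)\le\lambda\|\nabla V(\theta)\|^2$ for all $\theta\in\Theta$. Then the random variables $V(\theta_t)$, $t\le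 T$, are well defined and integrable, and $$V^*-\max_{0\le t\le T}\mathbb E[V(\theta_t)]\le\frac{2\lambda\,(V^*-V(\theta_0))}{\eta T}+\frac{\lambda\sigma^2}{N}+\frac{\lambda\sigma^2}{pNT}.$$ -/

import Mathlib

open MeasureTheory ProbabilityTheory

noncomputable section

/-- A discrete-time episodic Markov decision process with finite horizon `horizon ≥ 1`. -/
structure EpisodicMDP (S A : Type*) [MeasurableSpace S] [MeasurableSpace A] where
  /-- transition law `P(· | s, a)` -/
  trans : Kernel (S × A) S
  isMarkov_trans : IsMarkovKernel trans
  /-- reward function with values in `[-rmax, rmax]` -/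
  reward : S → A → ℝ
  measurable_reward : Measurable (fun x : S × A => reward x.1 x.2)
  rmax : ℝ
  rmax_pos : 0 < rmax
  abs_reward_le : ∀ s a, |reward s a| ≤ rmax
  /-- discount factor -/
  discount : ℝ
  discount_pos : 0 < discount
  discount_lt_one : discount < 1
  /-- initial state distribution -/
  init : Measure S
  isProb_init : IsProbabilityMeasure init
  horizon : ℕ
  horizon_pos : 0 < horizon

attribute [instance] EpisodicMDP.isMarkov_trans EpisodicMDP.isProb_init

/-- A class of stochastic stationary policies `π_θ`, `θ ∈ ℝ^d`: `dens θ s a` is the density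
`π_θ(a | s)` with respect to a reference measure `ν` on the action space (counting measure for
discrete actions, Lebesgue measure for continuous ones). The densities are positive, so that all
importance weights and all `log π_θ(a | s)` are well defined. -/
structure PolicyClass (d : ℕ) (S A : Type*) [MeasurableSpace S] [MeasurableSpace A]
    (ν : Measure A) where
  dens : EuclideanSpace ℝ (Fin d) → S → A → ℝ
  measurable_dens :
    Measurable (fun x : (EuclideanSpace ℝ (Fin d) × S) × A => dens x.1.1 x.1.2 x.2)
  dens_pos : ∀ θ s a, 0 < dens θ s a
  lintegral_dens : ∀ θ s, ∫⁻ a, ENNReal.ofReal (dens θ s a) ∂ν = 1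

namespace PagePG

variable {d : ℕ} {S A : Type*} [MeasurableSpace S] [MeasurableSpace A]
  {ν : Measure A} [SigmaFinite ν]

/-- The law `π_θ(· | s)` of the action, as a Markov kernel in `(θ, s)`. -/
def policyKernel (π : PolicyClass d S A ν) : Kernel (EuclideanSpace ℝ (Fin d) × S) A :=
  (Kernel.const (EuclideanSpace ℝ (Fin d) × S) ν).withDensity
    (fun x a => ENNReal.ofReal (π.dens x.1 x.2 a))

instance (π : PolicyClass d S A ν) : IsMarkovKernel (policyKernel π) := by
  refine ⟨fun x => ⟨?_⟩⟩
  have hm : Measurable (Function.uncurry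
      (fun (x : EuclideanSpace ℝ (Fin d) × S) a => ENNReal.ofReal (π.dens x.1 x.2 a))) :=
    π.measurable_dens.ennreal_ofReal
  rw [policyKernel, Kernel.withDensity_apply' _ hm]
  simpa using π.lintegral_dens x.1 x.2

/-- The law, given `(θ, s)`, of the first `n` state-action pairs `(s_0, a_0), …, (s_{n-1}, a_{n-1})`
when `s_0 = s`, `a_h ∼ π_θ(· | s_h)` and `s_{h+1} ∼ P(· | s_h, a_h)`. -/
def trajFrom (mdp : EpisodicMDP S A) (π : PolicyClass d S A ν) :
    (n : ℕ) → Kernel (EuclideanSpace ℝ (Fin d) × S) (Fin n → S × A)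
  | 0 => Kernel.const _ (Measure.dirac (fun i => i.elim0))
  | 1 => (Kernel.id ×ₖ policyKernel π).map
      (fun y : (EuclideanSpace ℝ (Fin d) × S) × A => fun _ : Fin 1 => (y.1.2, y.2))
  | n + 2 =>
      (trajFrom mdp π (n + 1) ⊗ₖ
        (mdp.trans.comap
            (fun x : (EuclideanSpace ℝ (Fin d) × S) × (Fin (n + 1) → S × A) => x.2 (Fin.last n))
            (by fun_prop) ⊗ₖ
          (policyKernel π).comap
            (fun y : ((EuclideanSpace ℝ (Fin d) × S) × (Fin (n + 1) → S × A)) × S =>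
              (y.1.1.1, y.2))
            (by fun_prop))).map
        (fun q : (Fin (n + 1) → S × A) × (S × A) =>
          (Fin.snoc q.1 q.2 : Fin (n + 2) → S × A))

instance (mdp : EpisodicMDP S A) (π : PolicyClass d S A ν) (n : ℕ) :
    IsMarkovKernel (trajFrom mdp π n) := by
  induction n using Nat.twoStepInduction with
  | zero => rw [trajFrom]; infer_instance
  | one =>
    rw [trajFrom]
    exact Kernel.IsMarkovKernel.map _ (by fun_prop)
  | more n _ ih =>
    rw [trajFrom]
    refine Kernel.IsMarkovKernel.map _ ?_
    refine measurable_pi_iff.mpr fun i => ?_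
    refine Fin.lastCases ?_ (fun j => ?_) i
    · simp only [Fin.snoc_last]; fun_prop
    · simp only [Fin.snoc_castSucc]; fun_prop

/-- The trajectory distribution `p(· | θ)`, with `s_0 ∼ ρ`. -/
def trajLaw (mdp : EpisodicMDP S A) (π : PolicyClass d S A ν) :
    Kernel (EuclideanSpace ℝ (Fin d)) (Fin mdp.horizon → S × A) :=
  trajFrom mdp π mdp.horizon ∘ₖ (Kernel.id ×ₖ Kernel.const _ mdp.init)

instance (mdp : EpisodicMDP S A) (π : PolicyClass d S A ν) :
    IsMarkovKernel (trajLaw mdp π) := by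
  rw [trajLaw]; infer_instance

/-- The discounted cumulative reward `R(τ) = ∑_{h<H} γ^h r(s_h, a_h)`. -/
def discountedReturn (mdp : EpisodicMDP S A) (τ : Fin mdp.horizon → S × A) : ℝ :=
  ∑ h : Fin mdp.horizon, mdp.discount ^ (h : ℕ) * mdp.reward (τ h).1 (τ h).2

/-- The value function `V^{π_θ}(s)`. -/
def stateValue (mdp : EpisodicMDP S A) (π : PolicyClass d S A ν)
    (θ : EuclideanSpace ℝ (Fin d)) (s : S) : ℝ :=
  ∫ τ, discountedReturn mdp τ ∂(trajFrom mdp π mdp.horizon (θ, s))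

/-- The objective `V(θ) = V^{π_θ}(ρ) = E_{s_0 ∼ ρ} V^{π_θ}(s_0)`. -/
def value (mdp : EpisodicMDP S A) (π : PolicyClass d S A ν)
    (θ : EuclideanSpace ℝ (Fin d)) : ℝ :=
  ∫ s, stateValue mdp π θ s ∂mdp.init

/-- The optimal value `V^* = sup_θ V(θ)`. -/
def optValue (mdp : EpisodicMDP S A) (π : PolicyClass d S A ν) : ℝ :=
  ⨆ θ, value mdp π θ

/-- The score `∇_θ log π_θ(a | s)`. -/
def score (π : PolicyClass d S A ν) (θ : EuclideanSpace ℝ (Fin d)) (s : S) (a : A) :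
    EuclideanSpace ℝ (Fin d) :=
  gradient (fun ϑ => Real.log (π.dens ϑ s a)) θ

/-- `Z_{θ,h} = ∑_{z ≤ h} ∇_θ log π_θ(a_z | s_z)`. -/
def scoreSum (π : PolicyClass d S A ν) {H : ℕ} (τ : Fin H → S × A)
    (θ : EuclideanSpace ℝ (Fin d)) (h : Fin H) : EuclideanSpace ℝ (Fin d) :=
  ∑ z ∈ Finset.Iic h, score π θ (τ z).1 (τ z).2

/-- The GPOMDP estimator `g(τ | θ) = ∑_{h<H} γ^h r(s_h, a_h) Z_{θ,h}`. -/
def gpomdp (mdp : EpisodicMDP S A) (π : PolicyClass d S A ν)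
    (τ : Fin mdp.horizon → S × A) (θ : EuclideanSpace ℝ (Fin d)) : EuclideanSpace ℝ (Fin d) :=
  ∑ h : Fin mdp.horizon,
    (mdp.discount ^ (h : ℕ) * mdp.reward (τ h).1 (τ h).2) • scoreSum π τ θ h

/-- The truncated importance weight
`ω_{0:h}(τ | θ₂, θ₁) = ∏_{j ≤ h} π_{θ₁}(a_j | s_j) / π_{θ₂}(a_j | s_j)`. -/
def truncWeight (π : PolicyClass d S A ν) {H : ℕ} (τ : Fin H → S × A)
    (θ₂ θ₁ : EuclideanSpace ℝ (Fin d)) (h : Fin H) : ℝ :=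
  ∏ j ∈ Finset.Iic h, π.dens θ₁ (τ j).1 (τ j).2 / π.dens θ₂ (τ j).1 (τ j).2

/-- The importance weight of the full trajectory,
`ω(τ | θ₂, θ₁) = p(τ | θ₁) / p(τ | θ₂) = ∏_{j < H} π_{θ₁}(a_j | s_j) / π_{θ₂}(a_j | s_j)`
(the initial and the transition probabilities cancel). -/
def fullWeight (π : PolicyClass d S A ν) {H : ℕ} (τ : Fin H → S × A)
    (θ₂ θ₁ : EuclideanSpace ℝ (Fin d)) : ℝ :=
  ∏ j : Fin H, π.dens θ₁ (τ j).1 (τ j).2 / π.dens θ₂ (τ j).1 (τ j).2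

/-- The off-policy GPOMDP estimator
`g^{ω_{θ₂}}(τ | θ₁) = ∑_{h<H} ω_{0:h}(τ | θ₂, θ₁) γ^h r(s_h, a_h) Z_{θ₁,h}`. -/
def gpomdpOff (mdp : EpisodicMDP S A) (π : PolicyClass d S A ν)
    (τ : Fin mdp.horizon → S × A) (θ₂ θ₁ : EuclideanSpace ℝ (Fin d)) :
    EuclideanSpace ℝ (Fin d) :=
  ∑ h : Fin mdp.horizon,
    (truncWeight π τ θ₂ θ₁ h * (mdp.discount ^ (h : ℕ) * mdp.reward (τ h).1 (τ h).2)) •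
      scoreSum π τ θ₁ h

/-- The law of `n` independent trajectories drawn from `p(· | θ)`. -/
def batchLaw (mdp : EpisodicMDP S A) (π : PolicyClass d S A ν) (n : ℕ)
    (θ : EuclideanSpace ℝ (Fin d)) : Measure (Fin n → Fin mdp.horizon → S × A) :=
  Measure.pi (fun _ : Fin n => trajLaw mdp π θ)

/-- The law of `(θ, v)` with `v = (1/N) ∑_{i<N} g(τ_i | θ)` for a fresh large batch drawn with
`θ`. -/
def largeBatch (mdp : EpisodicMDP S A) (π : PolicyClass d S A ν) (N : ℕ)
    (θ : EuclideanSpace ℝ (Fin d)) :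
    Measure (EuclideanSpace ℝ (Fin d) × EuclideanSpace ℝ (Fin d)) :=
  (batchLaw mdp π N θ).map (fun τ => (θ, (1 / (N : ℝ)) • ∑ i, gpomdp mdp π (τ i) θ))

/-- The law of `(θ, v)` with
`v = (1/B) ∑_{i<B} g(τ_i | θ) + v_prev - (1/B) ∑_{i<B} g^{ω_θ}(τ_i | θ_prev)` for a fresh small
batch drawn with `θ`. -/
def smallBatch (mdp : EpisodicMDP S A) (π : PolicyClass d S A ν) (B : ℕ)
    (θprev vprev θ : EuclideanSpace ℝ (Fin d)) :
    Measure (EuclideanSpace ℝ (Fin d) × EuclideanSpace ℝ (Fin d)) :=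
  (batchLaw mdp π B θ).map (fun τ =>
    (θ, (1 / (B : ℝ)) • ∑ i, gpomdp mdp π (τ i) θ + vprev -
      (1 / (B : ℝ)) • ∑ i, gpomdpOff mdp π (τ i) θ θprev))

/-- One iteration of PAGE-PG: the conditional law of `(θ_{t+1}, v_{t+1})` given `(θ_t, v_t) = x`.
Here `θ_{t+1} = θ_t + η v_t`; with probability `p` a large batch is used, and with probability
`1 - p` a small one. -/
def stepLaw (mdp : EpisodicMDP S A) (π : PolicyClass d S A ν) (N B : ℕ) (η p : ℝ)
    (x : EuclideanSpace ℝ (Fin d) × EuclideanSpace ℝ (Fin d)) :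
    Measure (EuclideanSpace ℝ (Fin d) × EuclideanSpace ℝ (Fin d)) :=
  ENNReal.ofReal p • largeBatch mdp π N (x.1 + η • x.2) +
    ENNReal.ofReal (1 - p) • smallBatch mdp π B x.1 x.2 (x.1 + η • x.2)

/-- The law of `(θ_t, v_t)` for PAGE-PG started at `θ_0`. -/
def iterLaw (mdp : EpisodicMDP S A) (π : PolicyClass d S A ν) (N B : ℕ) (η p : ℝ)
    (θ₀ : EuclideanSpace ℝ (Fin d)) :
    ℕ → Measure (EuclideanSpace ℝ (Fin d) × EuclideanSpace ℝ (Fin d))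
  | 0 => largeBatch mdp π N θ₀
  | t + 1 => (iterLaw mdp π N B η p θ₀ t).bind (stepLaw mdp π N B η p)

/-- Bounded log-policy gradient norm. -/
def BoundedScore (π : PolicyClass d S A ν) (G : ℝ) : Prop :=
  ∀ s a θ, ‖score π θ s a‖ ≤ G

/-- Smoothness: `π_θ` is twice differentiable in `θ` and `‖∇²_θ log π_θ(a | s)‖ ≤ M`. -/
def SmoothPolicy (π : PolicyClass d S A ν) (M : ℝ) : Prop :=
  ∀ s a, Differentiable ℝ (fun θ => π.dens θ s a) ∧
    Differentiable ℝ (fderiv ℝ (fun θ => π.dens θ s a)) ∧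
    ∀ θ, ‖fderiv ℝ (fun ϑ => score π ϑ s a) θ‖ ≤ M

/-- Finite variance: `Var g(τ | θ) ≤ σ²` for all `θ`, where `τ ∼ p(· | θ)`. -/
def FiniteVariance (mdp : EpisodicMDP S A) (π : PolicyClass d S A ν) (σ : ℝ) : Prop :=
  ∀ θ, ∫ τ, ‖gpomdp mdp π τ θ - ∫ τ', gpomdp mdp π τ' θ ∂(trajLaw mdp π θ)‖ ^ 2
    ∂(trajLaw mdp π θ) ≤ σ ^ 2

/-- Finite importance weight variance: `Var ω(τ | θ_b, θ_a) ≤ W` for all `θ_a, θ_b`, where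
`τ ∼ p(· | θ_b)`. -/
def FiniteWeightVariance (mdp : EpisodicMDP S A) (π : PolicyClass d S A ν) (W : ℝ) : Prop :=
  ∀ θa θb, evariance (fun τ => fullWeight π τ θb θa) (trajLaw mdp π θb) ≤ ENNReal.ofReal W

/-- Gradient dominancy on a set `Θ` of parameters: `V^* - V(θ) ≤ λ ‖∇V(θ)‖²` for `θ ∈ Θ`. -/
def GradientDominatedOn (mdp : EpisodicMDP S A) (π : PolicyClass d S A ν)
    (Θ : Set (EuclideanSpace ℝ (Fin d))) (lam : ℝ) : Prop :=
  ∀ θ ∈ Θ, optValue mdp π - value mdp π θ ≤ lam * ‖gradient (value mdp π) θ‖ ^ 2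

/-- The smoothness constant `L = M R / (1 - γ)² + 2 G² R / (1 - γ)³`. -/
def constL (R γ G M : ℝ) : ℝ :=
  M * R / (1 - γ) ^ 2 + 2 * G ^ 2 * R / (1 - γ) ^ 3

/-- `C_ω = 24 R G² (2 G² + M) (W + 1) γ / (1 - γ)⁵`. -/
def constCω (R γ G M W : ℝ) : ℝ :=
  24 * R * G ^ 2 * (2 * G ^ 2 + M) * (W + 1) * γ / (1 - γ) ^ 5

/-- `C = 2 (L² + C_ω)`. -/
def constC (R γ G M W : ℝ) : ℝ :=
  2 * (constL R γ G M ^ 2 + constCω R γ G M W)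

end PagePG

end

set_option linter.unusedSectionVars false

namespace PagePG

variable {d : ℕ} {S A : Type*} [MeasurableSpace S] [MeasurableSpace A]
  {ν : Measure A} [SigmaFinite ν]

/-! ### Laws of trajectories and changes of measure -/

/-! The proof follows the potential Φ(θ, v) = V* − V(θ) + (η/2p)‖v − ∇V(θ)‖². Expanding ⟨∇V, v⟩
through ‖v − ∇V‖², the descent inequality for an L-smooth objective gains (η/2)‖∇V‖² and (η/4)‖v‖²
and loses (η/2)‖v − ∇V‖². The loss is repaid because with probability p a large batch erases the old
error; this fixes the weight η/2p. A small batch keeps the old error and adds 1/B times a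
mean-square difference of estimators, which (η/4)‖v‖² absorbs if the off-policy estimator is
Lipschitz in mean square with constant of order L². Summing the drift of Φ over t < T bounds the
average of E‖∇V(θ_t)‖², and gradient dominance concludes.

Mean-square smoothness is proved for short steps (`integral_norm_gpomdpOff_sub_sq_le`). With the
sampling parameter θ₀ frozen, the estimator is the gradient of the importance-weighted return, so
along a segment it varies at a rate bounded by a weighted sum of the truncated weights. A likelihood
ratio in [e⁻ˣ, eˣ] of mean one has second moment at most 2 cosh x − 1, so E ω_{0:h}² ≤ (2 cosh x −
1)^(h+1). The discount γ^h beats this growth, uniformly in the horizon, for x = G‖θ₁ − θ₀‖ up to a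
suitable multiple of 1 − γ.

Nothing forces the steps of the algorithm to be short, so Φ is truncated at a level K. Where Φ ≤ K,
the error of v is controlled and the step is short enough. Where Φ > K, the truncation caps the
small-batch outcome at K while a large batch brings the expected potential far below it; K is chosen
so that this drop already pays for (η/2)‖∇V‖². The drift inequality `integral_potential_stepLaw_le`
therefore holds at every state. -/

lemma measurable_snoc (n : ℕ) : Measurable (fun q : (Fin n → S × A) × (S × A) =>
    (Fin.snoc q.1 q.2 : Fin (n + 1) → S × A)) := by
  refine measurable_pi_iff.mpr fun i => ?_
  refine Fin.lastCases ?_ (fun j => ?_) i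
  · simp only [Fin.snoc_last]; fun_prop
  · simp only [Fin.snoc_castSucc]; fun_prop

lemma lintegral_policyKernel (π : PolicyClass d S A ν) (x : EuclideanSpace ℝ (Fin d) × S)
    {F : A → ENNReal} (hF : Measurable F) :
    ∫⁻ a, F a ∂policyKernel π x = ∫⁻ a, ENNReal.ofReal (π.dens x.1 x.2 a) * F a ∂ν := by
  have hm : Measurable (Function.uncurry
      (fun (x : EuclideanSpace ℝ (Fin d) × S) a => ENNReal.ofReal (π.dens x.1 x.2 a))) :=
    π.measurable_dens.ennreal_ofReal
  rw [policyKernel, Kernel.lintegral_withDensity _ hm _ hF]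
  simp

/-- The likelihood ratio `π_{θ₁}(a | s) / π_{θ₂}(a | s)` at a state-action pair. -/
noncomputable def ratio (π : PolicyClass d S A ν) (θ₂ θ₁ : EuclideanSpace ℝ (Fin d)) (z : S × A) :
    ℝ :=
  π.dens θ₁ z.1 z.2 / π.dens θ₂ z.1 z.2

lemma ratio_pos (π : PolicyClass d S A ν) (θ₂ θ₁ : EuclideanSpace ℝ (Fin d)) (z : S × A) :
    0 < ratio π θ₂ θ₁ z := div_pos (π.dens_pos _ _ _) (π.dens_pos _ _ _)

@[fun_prop]
lemma measurable_dens_comp (π : PolicyClass d S A ν) {X : Type*} [MeasurableSpace X]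
    {f : X → EuclideanSpace ℝ (Fin d)} {g : X → S} {h : X → A} (hf : Measurable f)
    (hg : Measurable g) (hh : Measurable h) : Measurable (fun x => π.dens (f x) (g x) (h x)) :=
  π.measurable_dens.comp ((hf.prodMk hg).prodMk hh)

@[fun_prop]
lemma measurable_ratio (π : PolicyClass d S A ν) (θ₂ θ₁ : EuclideanSpace ℝ (Fin d)) :
    Measurable (ratio π θ₂ θ₁) := by
  unfold ratio
  fun_prop

lemma lintegral_ratio_mul (π : PolicyClass d S A ν) (θ₂ θ₁ : EuclideanSpace ℝ (Fin d)) (s : S)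
    {F : A → ENNReal} (hF : Measurable F) :
    ∫⁻ a, ENNReal.ofReal (ratio π θ₂ θ₁ (s, a)) * F a ∂policyKernel π (θ₂, s) =
      ∫⁻ a, F a ∂policyKernel π (θ₁, s) := by
  rw [lintegral_policyKernel _ _ (by fun_prop), lintegral_policyKernel _ _ hF]
  refine lintegral_congr fun a => ?_
  rw [← mul_assoc, ← ENNReal.ofReal_mul (π.dens_pos _ _ _).le, ratio]
  congr 3
  have := (π.dens_pos θ₂ s a).ne'
  field_simp

lemma lintegral_trajFrom_one (mdp : EpisodicMDP S A) (π : PolicyClass d S A ν)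
    (x : EuclideanSpace ℝ (Fin d) × S) {F : (Fin 1 → S × A) → ENNReal} (hF : Measurable F) :
    ∫⁻ τ, F τ ∂trajFrom mdp π 1 x = ∫⁻ a, F (fun _ => (x.2, a)) ∂policyKernel π x := by
  rw [trajFrom, Kernel.lintegral_map _ (by fun_prop) _ hF,
    Kernel.lintegral_prod _ _ _ (by fun_prop)]
  simp only [Kernel.id_apply]
  rw [lintegral_dirac' _ (Measurable.lintegral_prod_right' (f :=
    fun y : ((EuclideanSpace ℝ (Fin d) × S)) × A =>
    F (fun _ => (y.1.2, y.2))) (by fun_prop))]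

lemma lintegral_trajFrom_succ (mdp : EpisodicMDP S A) (π : PolicyClass d S A ν) (n : ℕ)
    (x : EuclideanSpace ℝ (Fin d) × S) {F : (Fin (n + 2) → S × A) → ENNReal} (hF : Measurable F) :
    ∫⁻ τ, F τ ∂trajFrom mdp π (n + 2) x =
      ∫⁻ τ, ∫⁻ s, ∫⁻ a, F (Fin.snoc τ (s, a)) ∂policyKernel π (x.1, s)
        ∂mdp.trans (τ (Fin.last n)) ∂trajFrom mdp π (n + 1) x := by
  have h1 : Measurable (fun q : (Fin (n + 1) → S × A) × (S × A) =>
      F (Fin.snoc q.1 q.2 : Fin (n + 2) → S × A)) := hF.comp (measurable_snoc (n + 1))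
  rw [trajFrom, Kernel.lintegral_map _ (measurable_snoc (n + 1)) _ hF,
    Kernel.lintegral_compProd _ _ _ h1]
  refine lintegral_congr fun τ => ?_
  have h2 : Measurable (fun c : S × A => F (Fin.snoc (τ, c).1 (τ, c).2)) :=
    h1.comp measurable_prodMk_left
  rw [Kernel.lintegral_compProd _ _ _ h2]
  rfl

lemma prod_snoc {M : Type*} [CommMonoid M] {X : Type*} {n : ℕ} (f : X → M) (τ : Fin n → X) (z : X) :
    ∏ j, f ((Fin.snoc τ z : Fin (n + 1) → X) j) = (∏ j, f (τ j)) * f z := by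
  rw [Fin.prod_univ_castSucc]
  simp

/-- Change of measure for trajectories started in a fixed state. -/
lemma lintegral_trajFrom_ratio (mdp : EpisodicMDP S A) (π : PolicyClass d S A ν)
    (θ₂ θ₁ : EuclideanSpace ℝ (Fin d)) (s : S) (n : ℕ) {F : (Fin (n + 1) → S × A) → ENNReal}
    (hF : Measurable F) :
    ∫⁻ τ, (∏ j, ENNReal.ofReal (ratio π θ₂ θ₁ (τ j))) * F τ ∂trajFrom mdp π (n + 1) (θ₂, s) =
      ∫⁻ τ, F τ ∂trajFrom mdp π (n + 1) (θ₁, s) := by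
  induction n with
  | zero =>
    rw [lintegral_trajFrom_one _ _ _ (by fun_prop), lintegral_trajFrom_one _ _ _ hF,
      ← lintegral_ratio_mul π θ₂ θ₁ s (by fun_prop)]
    simp
  | succ n ih =>
    have h1 : Measurable (fun q : (Fin (n + 1) → S × A) × (S × A) =>
      F (Fin.snoc q.1 q.2 : Fin (n + 2) → S × A)) := hF.comp (measurable_snoc (n + 1))
    rw [lintegral_trajFrom_succ _ _ _ _ (by fun_prop), lintegral_trajFrom_succ _ _ _ _ hF, ← ih]
    · refine lintegral_congr fun τ => ?_
      have h2 : ∀ s, Measurable (fun a => F (Fin.snoc τ (s, a))) := fun s =>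
        h1.comp (f := fun a : A => (τ, (s, a))) (by fun_prop)
      rw [← lintegral_const_mul]
      · refine lintegral_congr fun s' => ?_
        have h3 : Measurable
            (fun a => ENNReal.ofReal (ratio π θ₂ θ₁ (s', a)) * F (Fin.snoc τ (s', a))) :=
          Measurable.mul (by fun_prop) (h2 s')
        rw [← lintegral_ratio_mul π θ₂ θ₁ s' (h2 s'), ← lintegral_const_mul _ h3]
        refine lintegral_congr fun a => ?_
        rw [prod_snoc (fun z => ENNReal.ofReal (ratio π θ₂ θ₁ z)), mul_assoc]
      · exact Measurable.lintegral_kernel_prod_right'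
          (κ := (policyKernel π).comap (fun s' : S => (θ₁, s')) (by fun_prop))
          (f := fun y : S × A => F (Fin.snoc τ (y.1, y.2)))
          (h1.comp (f := fun y : S × A => (τ, (y.1, y.2))) (by fun_prop))
    · have h3 : Measurable (fun y : (Fin (n + 1) → S × A) × S =>
          ∫⁻ a, F (Fin.snoc y.1 (y.2, a)) ∂policyKernel π (θ₁, y.2)) :=
        Measurable.lintegral_kernel_prod_right'
          (κ := (policyKernel π).comap (fun y : (Fin (n + 1) → S × A) × S =>
            (θ₁, y.2)) (by fun_prop))
          (f := fun y : ((Fin (n + 1) → S × A) × S) × A => F (Fin.snoc y.1.1 (y.1.2, y.2)))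
          (h1.comp (f := fun y : ((Fin (n + 1) → S × A) × S) × A => (y.1.1, (y.1.2, y.2)))
            (by fun_prop))
      exact Measurable.lintegral_kernel_prod_right'
          (κ := mdp.trans.comap (fun τ : (Fin (n + 1) → S × A) => τ (Fin.last n)) (by fun_prop)) h3

/-- Discarding the last state-action pair of a trajectory. -/
lemma lintegral_trajFrom_init (mdp : EpisodicMDP S A) (π : PolicyClass d S A ν)
    (x : EuclideanSpace ℝ (Fin d) × S) (n : ℕ) {F : (Fin n → S × A) → ENNReal}
    (hF : Measurable F) :
    ∫⁻ τ, F (Fin.init τ) ∂trajFrom mdp π (n + 1) x = ∫⁻ τ, F τ ∂trajFrom mdp π n x := by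
  have hi : Measurable (fun τ : Fin (n + 1) → S × A => F (Fin.init τ)) := by
    unfold Fin.init; fun_prop
  cases n with
  | zero =>
    have : ∀ τ, F τ = F (fun i => i.elim0) := fun τ => congrArg F (Subsingleton.elim _ _)
    simp only [this, lintegral_const, measure_univ]
  | succ n =>
    rw [lintegral_trajFrom_succ _ _ _ _ hi]
    simp

/-- Conditionally on the past, each new action contributes a factor at most c whatever the current
state, so the transition law plays no role. The application is to φ equal to a squared likelihood
ratio. -/
lemma lintegral_trajFrom_prod_le (mdp : EpisodicMDP S A) (π : PolicyClass d S A ν)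
    (x : EuclideanSpace ℝ (Fin d) × S) {φ : S × A → ENNReal} (hφ : Measurable φ) {c : ENNReal}
    (hc : ∀ s, ∫⁻ a, φ (s, a) ∂policyKernel π (x.1, s) ≤ c) (n : ℕ) :
    ∫⁻ τ, ∏ j, φ (τ j) ∂trajFrom mdp π (n + 1) x ≤ c ^ (n + 1) := by
  induction n with
  | zero =>
    rw [lintegral_trajFrom_one _ _ _ (by fun_prop)]
    simpa using hc x.2
  | succ n ih =>
    rw [lintegral_trajFrom_succ _ _ _ _ (by fun_prop), pow_succ]
    calc _ ≤ ∫⁻ τ, (∏ j, φ (τ j)) * c ∂trajFrom mdp π (n + 1) x := by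
          refine lintegral_mono fun τ => ?_
          calc _ ≤ ∫⁻ _, (∏ j, φ (τ j)) * c ∂mdp.trans (τ (Fin.last n)) := by
                refine lintegral_mono fun s => ?_
                simp only [prod_snoc]
                rw [lintegral_const_mul _ (by fun_prop)]
                gcongr
                exact hc s
            _ = _ := by simp
      _ ≤ _ := by
          rw [lintegral_mul_const _ (by fun_prop)]
          gcongr

lemma lintegral_trajFrom_castLE (mdp : EpisodicMDP S A) (π : PolicyClass d S A ν)
    (x : EuclideanSpace ℝ (Fin d) × S) {m n : ℕ} (h : m ≤ n) {F : (Fin m → S × A) → ENNReal}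
    (hF : Measurable F) :
    ∫⁻ τ, F (fun j => τ (Fin.castLE h j)) ∂trajFrom mdp π n x = ∫⁻ τ, F τ ∂trajFrom mdp π m x := by
  induction n, h using Nat.le_induction with
  | base => simp
  | succ n hmn ih =>
    rw [← ih, ← lintegral_trajFrom_init mdp π x n
      (F := fun τ => F (fun j => τ (Fin.castLE hmn j))) (by fun_prop)]
    rfl

lemma lintegral_trajLaw (mdp : EpisodicMDP S A) (π : PolicyClass d S A ν)
    (θ : EuclideanSpace ℝ (Fin d)) {F : (Fin mdp.horizon → S × A) → ENNReal} (hF : Measurable F) :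
    ∫⁻ τ, F τ ∂trajLaw mdp π θ = ∫⁻ s, ∫⁻ τ, F τ ∂trajFrom mdp π mdp.horizon (θ, s) ∂mdp.init := by
  rw [trajLaw, Kernel.lintegral_comp _ _ _ hF,
    Kernel.lintegral_prod _ _ _ (Measurable.lintegral_kernel hF)]
  simp only [Kernel.id_apply, Kernel.const_apply]
  rw [lintegral_dirac' _ (Measurable.lintegral_prod_right' (f :=
    fun y : (EuclideanSpace ℝ (Fin d)) × S =>
    ∫⁻ τ, F τ ∂trajFrom mdp π mdp.horizon y) (Measurable.lintegral_kernel hF))]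

lemma truncWeight_eq_prod (π : PolicyClass d S A ν) {H : ℕ} (τ : Fin H → S × A)
    (θ₂ θ₁ : EuclideanSpace ℝ (Fin d)) (h : Fin H) :
    truncWeight π τ θ₂ θ₁ h =
      ∏ j : Fin (h + 1), ratio π θ₂ θ₁ (τ (Fin.castLE (Nat.succ_le_of_lt h.2) j)) := by
  rw [truncWeight]
  symm
  refine Finset.prod_bij (fun j _ => Fin.castLE (Nat.succ_le_of_lt h.2) j) ?_ ?_ ?_ ?_
  · intro j _
    rw [Finset.mem_Iic, Fin.le_def]
    exact Nat.lt_succ_iff.mp j.2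
  · intro i _ j _ hij
    exact Fin.castLE_injective _ hij
  · intro b hb
    rw [Finset.mem_Iic, Fin.le_def] at hb
    exact ⟨⟨b, Nat.lt_succ_of_le hb⟩, Finset.mem_univ _, rfl⟩
  · intro j _
    rfl

lemma truncWeight_pos (π : PolicyClass d S A ν) {H : ℕ} (τ : Fin H → S × A)
    (θ₂ θ₁ : EuclideanSpace ℝ (Fin d)) (h : Fin H) : 0 < truncWeight π τ θ₂ θ₁ h := by
  rw [truncWeight_eq_prod]
  exact Finset.prod_pos fun _ _ => ratio_pos _ _ _ _

@[fun_prop]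
lemma measurable_truncWeight (π : PolicyClass d S A ν) {H : ℕ}
    (θ₂ θ₁ : EuclideanSpace ℝ (Fin d)) (h : Fin H) :
    Measurable (fun τ : Fin H → S × A => truncWeight π τ θ₂ θ₁ h) := by
  simp only [truncWeight_eq_prod]
  fun_prop

/-- Change of measure for functions of the state-action pair at time `h`. -/
lemma lintegral_truncWeight_mul (mdp : EpisodicMDP S A) (π : PolicyClass d S A ν)
    (θ₂ θ₁ : EuclideanSpace ℝ (Fin d)) (h : Fin mdp.horizon) {F : S × A → ENNReal}
    (hF : Measurable F) :
    ∫⁻ τ, ENNReal.ofReal (truncWeight π τ θ₂ θ₁ h) * F (τ h) ∂trajLaw mdp π θ₂ =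
      ∫⁻ τ, F (τ h) ∂trajLaw mdp π θ₁ := by
  rw [lintegral_trajLaw _ _ _ (by fun_prop), lintegral_trajLaw _ _ _ (by fun_prop)]
  refine lintegral_congr fun s => ?_
  have hle := Nat.succ_le_of_lt h.2
  have h1 := lintegral_trajFrom_castLE mdp π (θ₂, s) hle (F := fun τ =>
    (∏ j, ENNReal.ofReal (ratio π θ₂ θ₁ (τ j))) * F (τ (Fin.last h))) (by fun_prop)
  have h2 := lintegral_trajFrom_castLE mdp π (θ₁, s) hle (F := fun τ => F (τ (Fin.last h)))
    (by fun_prop)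
  rw [lintegral_trajFrom_ratio _ _ _ _ _ _ (F := fun τ => F (τ (Fin.last h))) (by fun_prop),
    ← h2] at h1
  refine Eq.trans (lintegral_congr fun τ => ?_) h1
  rw [truncWeight_eq_prod, ENNReal.ofReal_prod_of_nonneg fun _ _ => (ratio_pos _ _ _ _).le]
  rfl

lemma lintegral_truncWeight_sq_le (mdp : EpisodicMDP S A) (π : PolicyClass d S A ν)
    (θ₂ θ₁ : EuclideanSpace ℝ (Fin d)) (h : Fin mdp.horizon) {c : ENNReal}
    (hc : ∀ s, ∫⁻ a, ENNReal.ofReal (ratio π θ₂ θ₁ (s, a) ^ 2) ∂policyKernel π (θ₂, s) ≤ c) :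
    ∫⁻ τ, ENNReal.ofReal (truncWeight π τ θ₂ θ₁ h ^ 2) ∂trajLaw mdp π θ₂ ≤ c ^ ((h : ℕ) + 1) := by
  rw [lintegral_trajLaw _ _ _ (by fun_prop)]
  calc _ ≤ ∫⁻ _, c ^ ((h : ℕ) + 1) ∂mdp.init := by
        refine lintegral_mono fun s => ?_
        have hle := Nat.succ_le_of_lt h.2
        have h1 := lintegral_trajFrom_castLE mdp π (θ₂, s) hle (F := fun τ =>
          (∏ j, ENNReal.ofReal (ratio π θ₂ θ₁ (τ j) ^ 2))) (by fun_prop)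
        have h2 := lintegral_trajFrom_prod_le mdp π (θ₂, s)
          (φ := fun z => ENNReal.ofReal (ratio π θ₂ θ₁ z ^ 2)) (by fun_prop) hc h
        refine le_trans (le_of_eq ?_) (h1.trans_le h2)
        refine lintegral_congr fun τ => ?_
        rw [truncWeight_eq_prod, ← ENNReal.ofReal_prod_of_nonneg fun _ _ => sq_nonneg _,
          Finset.prod_pow]
    _ = _ := by simp

lemma integral_truncWeight_mul (mdp : EpisodicMDP S A) (π : PolicyClass d S A ν)
    (θ₂ θ₁ : EuclideanSpace ℝ (Fin d)) (h : Fin mdp.horizon) {f : S × A → ℝ}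
    (hf : Measurable f) :
    ∫ τ, truncWeight π τ θ₂ θ₁ h * f (τ h) ∂trajLaw mdp π θ₂ =
      ∫ τ, f (τ h) ∂trajLaw mdp π θ₁ := by
  have hm : Measurable (fun τ : Fin mdp.horizon → S × A =>
    ENNReal.ofReal (truncWeight π τ θ₂ θ₁ h)) := by fun_prop
  -- The weight stops at time h, so only the marginals at time h need agree. Stated as an equality
  -- of measures, the identity passes to Bochner integrals with no integrability hypothesis on f.
  have key : ((trajLaw mdp π θ₂).withDensity
      (fun τ => ENNReal.ofReal (truncWeight π τ θ₂ θ₁ h))).map (fun τ => τ h) =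
      (trajLaw mdp π θ₁).map (fun τ => τ h) := by
    refine Measure.ext_of_lintegral _ fun F hF => ?_
    rw [lintegral_map hF (by fun_prop), lintegral_map hF (by fun_prop),
      lintegral_withDensity_eq_lintegral_mul _ hm (by fun_prop),
      ← lintegral_truncWeight_mul mdp π θ₂ θ₁ h hF]
    rfl
  rw [← integral_map (φ := fun τ : Fin mdp.horizon → S × A => τ h)
    (measurable_pi_apply h).aemeasurable hf.aestronglyMeasurable, ← key, integral_map (measurable_pi_apply h).aemeasurable
      hf.aestronglyMeasurable,
    integral_withDensity_eq_integral_toReal_smul hm (by simp)]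
  refine integral_congr_ae (Filter.Eventually.of_forall fun τ => ?_)
  simp only [smul_eq_mul]
  rw [ENNReal.toReal_ofReal (truncWeight_pos _ _ _ _ _).le]

lemma integral_truncWeight (mdp : EpisodicMDP S A) (π : PolicyClass d S A ν)
    (θ₂ θ₁ : EuclideanSpace ℝ (Fin d)) (h : Fin mdp.horizon) :
    ∫ τ, truncWeight π τ θ₂ θ₁ h ∂trajLaw mdp π θ₂ = 1 := by
  simpa using integral_truncWeight_mul mdp π θ₂ θ₁ h (f := fun _ => 1) measurable_const

/-- The objective is the expected return over the trajectory distribution. -/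
lemma value_eq_integral (mdp : EpisodicMDP S A) (π : PolicyClass d S A ν)
    (θ : EuclideanSpace ℝ (Fin d)) :
    value mdp π θ = ∫ τ, discountedReturn mdp τ ∂trajLaw mdp π θ := by
  have hr : Measurable (fun z : S × A => mdp.reward z.1 z.2) := mdp.measurable_reward
  have hm : Measurable (discountedReturn mdp) := by
    unfold discountedReturn
    exact Finset.measurable_sum _ fun h _ => (hr.comp (measurable_pi_apply h)).const_mul _
  have hi : Integrable (discountedReturn mdp) (trajLaw mdp π θ) := by
    refine Integrable.of_bound hm.aestronglyMeasurable
      (∑ h : Fin mdp.horizon, mdp.discount ^ (h : ℕ) * mdp.rmax)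
        (Filter.Eventually.of_forall fun τ => ?_)
    refine norm_sum_le_of_le _ fun h _ => ?_
    rw [norm_mul, Real.norm_of_nonneg (pow_nonneg mdp.discount_pos.le _)]
    exact mul_le_mul_of_nonneg_left (mdp.abs_reward_le _ _) (pow_nonneg mdp.discount_pos.le _)
  have hi' := hi
  rw [trajLaw] at hi
  rw [trajLaw, Kernel.integral_comp hi, Kernel.prod_apply, Kernel.id_apply, Kernel.const_apply,
    Measure.dirac_prod, integral_map (by fun_prop)]
  · rfl
  · exact (StronglyMeasurable.integral_kernel hm.stronglyMeasurable).aestronglyMeasurable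

/-! ### Likelihood ratios under a bounded score -/

/-- A ratio r in [e⁻ˣ, eˣ] satisfies (eˣ − r)(r − e⁻ˣ) ≥ 0, that is r² + 1 ≤ 2 cosh x · r, and r has
mean one. The excess over 1 is thus of second order in x. -/
lemma lintegral_ratio_sq_le (π : PolicyClass d S A ν) (θ₂ θ₁ : EuclideanSpace ℝ (Fin d)) {x : ℝ}
    (hx : ∀ z, |Real.log (ratio π θ₂ θ₁ z)| ≤ x) (s : S) :
    ∫⁻ a, ENNReal.ofReal (ratio π θ₂ θ₁ (s, a) ^ 2) ∂policyKernel π (θ₂, s) ≤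
      ENNReal.ofReal (2 * Real.cosh x - 1) := by
  have hc : 0 ≤ 2 * Real.cosh x - 1 := by linarith [Real.one_le_cosh x]
  have h1 : ∫⁻ a, ENNReal.ofReal (ratio π θ₂ θ₁ (s, a)) ∂policyKernel π (θ₂, s) = 1 := by
    simpa using lintegral_ratio_mul π θ₂ θ₁ s (F := fun _ => 1) measurable_const
  -- The summand 1 stays on the left and is cancelled at the end, which avoids subtraction in
  -- `ENNReal`.
  have h2 : ∫⁻ a, (ENNReal.ofReal (ratio π θ₂ θ₁ (s, a) ^ 2) + 1) ∂policyKernel π (θ₂, s) ≤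
      ∫⁻ a, ENNReal.ofReal (2 * Real.cosh x) * ENNReal.ofReal (ratio π θ₂ θ₁ (s, a))
        ∂policyKernel π (θ₂, s) := by
    refine lintegral_mono fun a => ?_
    have hp := ratio_pos π θ₂ θ₁ (s, a)
    obtain ⟨hl, hu⟩ := abs_le.mp (hx (s, a))
    rw [← ENNReal.ofReal_one, ← ENNReal.ofReal_add (sq_nonneg _) zero_le_one,
      ← ENNReal.ofReal_mul (by linarith)]
    refine ENNReal.ofReal_le_ofReal ?_
    have hu' : ratio π θ₂ θ₁ (s, a) ≤ Real.exp x := (Real.log_le_iff_le_exp hp).mp hu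
    have hl' : Real.exp (-x) ≤ ratio π θ₂ θ₁ (s, a) := (Real.le_log_iff_exp_le hp).mp hl
    have he : Real.exp x * Real.exp (-x) = 1 := by rw [← Real.exp_add]; simp
    rw [Real.cosh_eq]
    nlinarith [mul_nonneg (sub_nonneg.mpr hu') (sub_nonneg.mpr hl')]
  rw [lintegral_add_right _ measurable_const, lintegral_const_mul _ (by fun_prop), h1,
    lintegral_const, measure_univ, mul_one, mul_one] at h2
  have h3 : ENNReal.ofReal (2 * Real.cosh x) = ENNReal.ofReal (2 * Real.cosh x - 1) + 1 := by
    rw [← ENNReal.ofReal_one, ← ENNReal.ofReal_add hc zero_le_one, sub_add_cancel]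
  rw [h3] at h2
  exact (ENNReal.add_le_add_iff_right ENNReal.one_ne_top).mp h2

/-! ### Regularity of the policy class -/

lemma SmoothPolicy.hasGradientAt_log {π : PolicyClass d S A ν} {M : ℝ} (h : SmoothPolicy π M)
    (θ : EuclideanSpace ℝ (Fin d)) (s : S) (a : A) :
    HasGradientAt (fun ϑ => Real.log (π.dens ϑ s a)) (score π θ s a) θ :=
  (((h s a).1 θ).log (π.dens_pos θ s a).ne').hasGradientAt

lemma SmoothPolicy.differentiable_score {π : PolicyClass d S A ν} {M : ℝ} (h : SmoothPolicy π M)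
    (s : S) (a : A) : Differentiable ℝ (fun ϑ => score π ϑ s a) := by
  have h1 : (fun ϑ => score π ϑ s a) = fun ϑ =>
      (InnerProductSpace.toDual ℝ (EuclideanSpace ℝ (Fin d))).symm
        ((π.dens ϑ s a)⁻¹ • fderiv ℝ (fun θ => π.dens θ s a) ϑ) := by
    funext ϑ
    rw [score, gradient, fderiv.log ((h s a).1 ϑ) (π.dens_pos ϑ s a).ne']
  rw [h1]
  have h2 : Differentiable ℝ (fun ϑ =>
      (π.dens ϑ s a)⁻¹ • fderiv ℝ (fun θ => π.dens θ s a) ϑ) :=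
    ((h s a).1.inv fun ϑ => (π.dens_pos ϑ s a).ne').smul (h s a).2.1
  exact (InnerProductSpace.toDual ℝ
    (EuclideanSpace ℝ (Fin d))).symm.toContinuousLinearEquiv.differentiable.comp h2

lemma SmoothPolicy.norm_score_sub_le {π : PolicyClass d S A ν} {M : ℝ} (h : SmoothPolicy π M)
    (θ₁ θ₂ : EuclideanSpace ℝ (Fin d)) (s : S) (a : A) :
    ‖score π θ₁ s a - score π θ₂ s a‖ ≤ M * ‖θ₁ - θ₂‖ :=
  Convex.norm_image_sub_le_of_norm_fderiv_le (𝕜 := ℝ) (f := fun ϑ => score π ϑ s a)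
    (fun x _ => h.differentiable_score s a x) (fun x _ => (h s a).2.2 x) convex_univ
    (Set.mem_univ _) (Set.mem_univ _)

lemma abs_log_dens_sub_le {π : PolicyClass d S A ν} {M G : ℝ} (h : SmoothPolicy π M)
    (hG : BoundedScore π G) (θ₁ θ₂ : EuclideanSpace ℝ (Fin d)) (s : S) (a : A) :
    |Real.log (π.dens θ₁ s a) - Real.log (π.dens θ₂ s a)| ≤ G * ‖θ₁ - θ₂‖ := by
  refine Convex.norm_image_sub_le_of_norm_hasFDerivWithin_le (𝕜 := ℝ)
    (f := fun ϑ => Real.log (π.dens ϑ s a))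
    (fun x _ => (h.hasGradientAt_log x s a).hasFDerivAt.hasFDerivWithinAt) (fun x _ => ?_)
    convex_univ (Set.mem_univ _) (Set.mem_univ _)
  rw [LinearIsometryEquiv.norm_map]
  exact hG s a x

lemma log_ratio (π : PolicyClass d S A ν) (θ₂ θ₁ : EuclideanSpace ℝ (Fin d)) (z : S × A) :
    Real.log (ratio π θ₂ θ₁ z) =
      Real.log (π.dens θ₁ z.1 z.2) - Real.log (π.dens θ₂ z.1 z.2) :=
  Real.log_div (π.dens_pos _ _ _).ne' (π.dens_pos _ _ _).ne'

/-- Each coordinate of the score is a pointwise limit of difference quotients of the jointly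
measurable log-density. -/
lemma SmoothPolicy.measurable_score {π : PolicyClass d S A ν} {M : ℝ} (h : SmoothPolicy π M) :
    Measurable (fun x : (EuclideanSpace ℝ (Fin d) × S) × A => score π x.1.1 x.1.2 x.2) := by
  suffices hi : ∀ i, Measurable (fun x : (EuclideanSpace ℝ (Fin d) × S) × A =>
      score π x.1.1 x.1.2 x.2 i) from
    (MeasurableEquiv.toLp 2 (Fin d → ℝ)).measurable.comp (measurable_pi_iff.mpr hi)
  intro i
  let e : EuclideanSpace ℝ (Fin d) := EuclideanSpace.single i 1
  refine measurable_of_tendsto_metrizable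
    (f := fun (n : ℕ) (x : (EuclideanSpace ℝ (Fin d) × S) × A) =>
      ((1 / ((n : ℝ) + 1)))⁻¹ • (Real.log (π.dens (x.1.1 + (1 / ((n : ℝ) + 1)) • e) x.1.2 x.2) -
        Real.log (π.dens x.1.1 x.1.2 x.2))) (fun n => by fun_prop) ?_
  refine tendsto_pi_nhds.mpr fun x => ?_
  have hd := (h.hasGradientAt_log x.1.1 x.1.2 x.2).hasFDerivAt.hasLineDerivAt e
  have ht := hd.tendsto_slope_zero_right.comp
    (tendsto_nhdsWithin_iff.mpr ⟨tendsto_one_div_add_atTop_nhds_zero_nat (𝕜 := ℝ),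
      Filter.Eventually.of_forall fun n : ℕ => by
        simp only [Set.mem_Ioi]; positivity⟩)
  have hv : (InnerProductSpace.toDual ℝ (EuclideanSpace ℝ (Fin d))) (score π x.1.1 x.1.2 x.2) e =
      score π x.1.1 x.1.2 x.2 i := by
    rw [InnerProductSpace.toDual_apply_apply]
    simp [e, EuclideanSpace.inner_single_right]
  rw [hv] at ht
  simpa [Function.comp_def] using ht

lemma SmoothPolicy.measurable_score_comp {π : PolicyClass d S A ν} {M : ℝ}
    (h : SmoothPolicy π M) {X : Type*} [MeasurableSpace X]
    {f : X → EuclideanSpace ℝ (Fin d)} {g : X → S × A} (hf : Measurable f)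
    (hg : Measurable g) : Measurable (fun x => score π (f x) (g x).1 (g x).2) :=
  h.measurable_score.comp ((hf.prodMk hg.fst).prodMk hg.snd)

/-! ### Truncated importance weights and score sums -/

lemma truncWeight_eq_exp (π : PolicyClass d S A ν) {H : ℕ} (τ : Fin H → S × A)
    (θ₂ θ₁ : EuclideanSpace ℝ (Fin d)) (h : Fin H) :
    truncWeight π τ θ₂ θ₁ h = Real.exp (∑ z ∈ Finset.Iic h,
      (Real.log (π.dens θ₁ (τ z).1 (τ z).2) - Real.log (π.dens θ₂ (τ z).1 (τ z).2))) := by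
  rw [Real.exp_sum, truncWeight]
  refine Finset.prod_congr rfl fun z _ => ?_
  rw [← Real.log_div (π.dens_pos _ _ _).ne' (π.dens_pos _ _ _).ne',
    Real.exp_log (div_pos (π.dens_pos _ _ _) (π.dens_pos _ _ _))]

lemma truncWeight_self (π : PolicyClass d S A ν) {H : ℕ} (τ : Fin H → S × A)
    (θ : EuclideanSpace ℝ (Fin d)) (h : Fin H) : truncWeight π τ θ θ h = 1 := by
  rw [truncWeight_eq_exp]
  simp

lemma norm_sum_Iic_le {E : Type*} [SeminormedAddCommGroup E] {H : ℕ} (h : Fin H) {f : Fin H → E}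
    {c : ℝ} (hf : ∀ z, ‖f z‖ ≤ c) : ‖∑ z ∈ Finset.Iic h, f z‖ ≤ ((h : ℝ) + 1) * c := by
  refine (norm_sum_le_of_le _ fun z _ => hf z).trans (le_of_eq ?_)
  rw [Finset.sum_const, Fin.card_Iic, nsmul_eq_mul]
  push_cast
  ring

lemma truncWeight_le_mul {π : PolicyClass d S A ν} {M G : ℝ} (hM : SmoothPolicy π M)
    (hG : BoundedScore π G) {H : ℕ} (τ : Fin H → S × A)
    (θ₀ θ₁ θ₂ : EuclideanSpace ℝ (Fin d)) (h : Fin H) :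
    truncWeight π τ θ₀ θ₂ h ≤
      truncWeight π τ θ₀ θ₁ h * Real.exp (((h : ℝ) + 1) * (G * ‖θ₂ - θ₁‖)) := by
  rw [truncWeight_eq_exp, truncWeight_eq_exp, ← Real.exp_add]
  refine Real.exp_le_exp.mpr ?_
  have h1 := (abs_le.mp (norm_sum_Iic_le h (f := fun z => Real.log (π.dens θ₂ (τ z).1 (τ z).2) -
    Real.log (π.dens θ₁ (τ z).1 (τ z).2))
    fun z => abs_log_dens_sub_le hM hG θ₂ θ₁ (τ z).1 (τ z).2)).2
  simp only [Finset.sum_sub_distrib] at h1 ⊢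
  linarith

lemma truncWeight_le {π : PolicyClass d S A ν} {M G : ℝ} (hM : SmoothPolicy π M)
    (hG : BoundedScore π G) {H : ℕ} (τ : Fin H → S × A)
    (θ₀ θ₁ : EuclideanSpace ℝ (Fin d)) (h : Fin H) :
    truncWeight π τ θ₀ θ₁ h ≤ Real.exp (((h : ℝ) + 1) * (G * ‖θ₁ - θ₀‖)) := by
  simpa [truncWeight_self] using truncWeight_le_mul hM hG τ θ₀ θ₀ θ₁ h

/-- The two weights differ by a factor e^u with |u| ≤ y, and |1 − e^u| ≤ y e^y. The bound keeps the
weight at θ₁ as a factor, so its mean one and its second moment under θ₀ remain usable. -/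
lemma abs_truncWeight_sub_le {π : PolicyClass d S A ν} {M G : ℝ} (hM : SmoothPolicy π M)
    (hG : BoundedScore π G) {H : ℕ} (τ : Fin H → S × A)
    (θ₀ θ₁ θ₂ : EuclideanSpace ℝ (Fin d)) (h : Fin H) :
    |truncWeight π τ θ₀ θ₁ h - truncWeight π τ θ₀ θ₂ h| ≤
      truncWeight π τ θ₀ θ₁ h * (((h : ℝ) + 1) * (G * ‖θ₁ - θ₂‖) *
        Real.exp (((h : ℝ) + 1) * (G * ‖θ₁ - θ₂‖))) := by
  set y := ((h : ℝ) + 1) * (G * ‖θ₁ - θ₂‖) with hy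
  have h1 := norm_sum_Iic_le h (f := fun z => Real.log (π.dens θ₂ (τ z).1 (τ z).2) -
    Real.log (π.dens θ₁ (τ z).1 (τ z).2))
    fun z => abs_log_dens_sub_le hM hG θ₂ θ₁ (τ z).1 (τ z).2
  rw [norm_sub_rev θ₂ θ₁, ← hy] at h1
  set u := ∑ z ∈ Finset.Iic h, (Real.log (π.dens θ₂ (τ z).1 (τ z).2) -
    Real.log (π.dens θ₁ (τ z).1 (τ z).2)) with hu
  have h2 : truncWeight π τ θ₀ θ₂ h = truncWeight π τ θ₀ θ₁ h * Real.exp u := by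
    rw [truncWeight_eq_exp, truncWeight_eq_exp, ← Real.exp_add, hu, ← Finset.sum_add_distrib]
    congr 1
    exact Finset.sum_congr rfl fun z _ => by ring
  have hp := truncWeight_pos π τ θ₀ θ₁ h
  have h3 : |1 - Real.exp u| ≤ y * Real.exp y := by
    obtain ⟨hl, hr⟩ := abs_le.mp h1
    have e1 := Real.add_one_le_exp u
    have e2 := Real.add_one_le_exp (-y)
    have e3 : Real.exp y * Real.exp (-y) = 1 := by rw [← Real.exp_add]; simp
    have e4 := Real.exp_le_exp.mpr hr
    have e5 : 1 ≤ Real.exp y := by linarith [Real.add_one_le_exp y, (abs_nonneg u).trans h1]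
    have hy0 : 0 ≤ y := (abs_nonneg u).trans h1
    rw [abs_le]
    constructor
    · nlinarith [Real.exp_pos y]
    · nlinarith
  rw [h2, ← mul_one_sub, abs_mul, abs_of_pos hp]
  exact mul_le_mul_of_nonneg_left h3 hp.le

lemma norm_scoreSum_le {π : PolicyClass d S A ν} {G : ℝ} (hG : BoundedScore π G) {H : ℕ}
    (τ : Fin H → S × A) (θ : EuclideanSpace ℝ (Fin d)) (h : Fin H) :
    ‖scoreSum π τ θ h‖ ≤ ((h : ℝ) + 1) * G :=
  norm_sum_Iic_le h fun _ => hG _ _ _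

lemma norm_scoreSum_sub_le {π : PolicyClass d S A ν} {M : ℝ} (hM : SmoothPolicy π M) {H : ℕ}
    (τ : Fin H → S × A) (θ₁ θ₂ : EuclideanSpace ℝ (Fin d)) (h : Fin H) :
    ‖scoreSum π τ θ₁ h - scoreSum π τ θ₂ h‖ ≤ ((h : ℝ) + 1) * (M * ‖θ₁ - θ₂‖) := by
  rw [scoreSum, scoreSum, ← Finset.sum_sub_distrib]
  exact norm_sum_Iic_le h fun _ => hM.norm_score_sub_le _ _ _ _

/-- The difference splits into a change of score (the term in M) and a change of weight (the term in
G²). The exponential factor depends on the horizon but tends to 1 on short segments, which is how it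
is later removed. -/
lemma norm_truncWeight_smul_scoreSum_sub_le {π : PolicyClass d S A ν} {M G : ℝ}
    (hM : SmoothPolicy π M) (hG : BoundedScore π G) (hG0 : 0 ≤ G) (hM0 : 0 ≤ M) {H : ℕ}
    (τ : Fin H → S × A) (θ₀ θ₁ θ₂ : EuclideanSpace ℝ (Fin d)) (h : Fin H) :
    ‖truncWeight π τ θ₀ θ₁ h • scoreSum π τ θ₁ h - truncWeight π τ θ₀ θ₂ h • scoreSum π τ θ₂ h‖ ≤
      Real.exp (H * (G * ‖θ₁ - θ₂‖)) * ‖θ₁ - θ₂‖ *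
        ((((h : ℝ) + 1) * M + ((h : ℝ) + 1) ^ 2 * G ^ 2) * truncWeight π τ θ₀ θ₁ h) := by
  have hp := truncWeight_pos π τ θ₀ θ₁ h
  set w := truncWeight π τ θ₀ θ₁ h
  set y := ((h : ℝ) + 1) * (G * ‖θ₁ - θ₂‖) with hy
  have hyH : Real.exp y ≤ Real.exp (H * (G * ‖θ₁ - θ₂‖)) := by
    refine Real.exp_le_exp.mpr (mul_le_mul_of_nonneg_right ?_ (by positivity))
    exact_mod_cast h.2
  have h1 : 1 ≤ Real.exp y := Real.one_le_exp (by positivity)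
  have key : w • scoreSum π τ θ₁ h - truncWeight π τ θ₀ θ₂ h • scoreSum π τ θ₂ h =
      w • (scoreSum π τ θ₁ h - scoreSum π τ θ₂ h) +
        (w - truncWeight π τ θ₀ θ₂ h) • scoreSum π τ θ₂ h := by module
  rw [key]
  refine (norm_add_le _ _).trans ?_
  rw [norm_smul, norm_smul, Real.norm_of_nonneg hp.le, Real.norm_eq_abs]
  have b1 : w * ‖scoreSum π τ θ₁ h - scoreSum π τ θ₂ h‖ ≤
      w * (Real.exp y * (((h : ℝ) + 1) * (M * ‖θ₁ - θ₂‖))) := by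
    refine mul_le_mul_of_nonneg_left ((norm_scoreSum_sub_le hM τ θ₁ θ₂ h).trans ?_) hp.le
    exact le_mul_of_one_le_left (by positivity) h1
  have b2 : |w - truncWeight π τ θ₀ θ₂ h| * ‖scoreSum π τ θ₂ h‖ ≤
      w * (y * Real.exp y) * (((h : ℝ) + 1) * G) :=
    mul_le_mul (abs_truncWeight_sub_le hM hG τ θ₀ θ₁ θ₂ h) (norm_scoreSum_le hG τ θ₂ h)
      (norm_nonneg _) (by positivity)
  calc _ ≤ Real.exp y * (‖θ₁ - θ₂‖ *
        ((((h : ℝ) + 1) * M + ((h : ℝ) + 1) ^ 2 * G ^ 2) * w)) := by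
        refine (add_le_add b1 b2).trans (le_of_eq ?_)
        rw [hy]
        ring
    _ ≤ _ := by
        rw [mul_assoc]
        exact mul_le_mul_of_nonneg_right hyH (by positivity)

/-! ### The off-policy estimator and differentiation of the objective -/

lemma gpomdpOff_self (mdp : EpisodicMDP S A) (π : PolicyClass d S A ν)
    (τ : Fin mdp.horizon → S × A) (θ : EuclideanSpace ℝ (Fin d)) :
    gpomdpOff mdp π τ θ θ = gpomdp mdp π τ θ := by
  simp [gpomdpOff, gpomdp, truncWeight_self]

/-- Uniform bound on the norm of the on-policy estimator. -/
noncomputable def gradBound (mdp : EpisodicMDP S A) (G : ℝ) : ℝ :=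
  ∑ h : Fin mdp.horizon, mdp.discount ^ (h : ℕ) * mdp.rmax * (((h : ℝ) + 1) * G)

/-- The Lipschitz modulus of the `h`-th summand of the off-policy estimator. -/
noncomputable def lipCoeff (mdp : EpisodicMDP S A) (M G : ℝ) (h : Fin mdp.horizon) : ℝ :=
  mdp.discount ^ (h : ℕ) * mdp.rmax * (((h : ℝ) + 1) * M + ((h : ℝ) + 1) ^ 2 * G ^ 2)

lemma lipCoeff_nonneg (mdp : EpisodicMDP S A) {M G : ℝ} (hM : 0 ≤ M) (h : Fin mdp.horizon) :
    0 ≤ lipCoeff mdp M G h := by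
  have := mdp.discount_pos.le
  have := mdp.rmax_pos.le
  unfold lipCoeff
  positivity

lemma abs_discounted_reward_le (mdp : EpisodicMDP S A) (τ : Fin mdp.horizon → S × A)
    (h : Fin mdp.horizon) : |mdp.discount ^ (h : ℕ) * mdp.reward (τ h).1 (τ h).2| ≤
      mdp.discount ^ (h : ℕ) * mdp.rmax := by
  rw [abs_mul, abs_of_nonneg (pow_nonneg mdp.discount_pos.le _)]
  exact mul_le_mul_of_nonneg_left (mdp.abs_reward_le _ _) (pow_nonneg mdp.discount_pos.le _)

lemma norm_gpomdpOff_le (mdp : EpisodicMDP S A) {π : PolicyClass d S A ν} {M G : ℝ}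
    (hM : SmoothPolicy π M) (hG : BoundedScore π G) (hG0 : 0 ≤ G)
    (τ : Fin mdp.horizon → S × A) (θ₀ θ₁ : EuclideanSpace ℝ (Fin d)) :
    ‖gpomdpOff mdp π τ θ₀ θ₁‖ ≤
      Real.exp (mdp.horizon * (G * ‖θ₁ - θ₀‖)) * gradBound mdp G := by
  rw [gpomdpOff, gradBound, Finset.mul_sum]
  refine norm_sum_le_of_le _ fun h _ => ?_
  have hp := truncWeight_pos π τ θ₀ θ₁ h
  rw [norm_smul, norm_mul, Real.norm_of_nonneg hp.le, Real.norm_eq_abs, mul_assoc]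
  have h1 : truncWeight π τ θ₀ θ₁ h ≤ Real.exp (mdp.horizon * (G * ‖θ₁ - θ₀‖)) := by
    refine (truncWeight_le hM hG τ θ₀ θ₁ h).trans (Real.exp_le_exp.mpr ?_)
    refine mul_le_mul_of_nonneg_right ?_ (by positivity)
    exact_mod_cast h.2
  exact mul_le_mul h1 (mul_le_mul (abs_discounted_reward_le mdp τ h) (norm_scoreSum_le hG τ θ₁ h)
    (norm_nonneg _) (mul_nonneg (pow_nonneg mdp.discount_pos.le _) mdp.rmax_pos.le))
    (by positivity) (by positivity)

lemma norm_gpomdp_le (mdp : EpisodicMDP S A) {π : PolicyClass d S A ν} {M G : ℝ}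
    (hM : SmoothPolicy π M) (hG : BoundedScore π G) (hG0 : 0 ≤ G)
    (τ : Fin mdp.horizon → S × A) (θ : EuclideanSpace ℝ (Fin d)) :
    ‖gpomdp mdp π τ θ‖ ≤ gradBound mdp G := by
  simpa [gpomdpOff_self] using norm_gpomdpOff_le mdp hM hG hG0 τ θ θ

lemma norm_gpomdpOff_sub_le (mdp : EpisodicMDP S A) {π : PolicyClass d S A ν} {M G : ℝ}
    (hM : SmoothPolicy π M) (hG : BoundedScore π G) (hG0 : 0 ≤ G) (hM0 : 0 ≤ M)
    (τ : Fin mdp.horizon → S × A) (θ₀ θ₁ θ₂ : EuclideanSpace ℝ (Fin d)) :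
    ‖gpomdpOff mdp π τ θ₀ θ₁ - gpomdpOff mdp π τ θ₀ θ₂‖ ≤
      Real.exp (mdp.horizon * (G * ‖θ₁ - θ₂‖)) * ‖θ₁ - θ₂‖ *
        ∑ h, lipCoeff mdp M G h * truncWeight π τ θ₀ θ₁ h := by
  rw [gpomdpOff, gpomdpOff, ← Finset.sum_sub_distrib, Finset.mul_sum]
  refine norm_sum_le_of_le _ fun h _ => ?_
  rw [mul_comm (truncWeight π τ θ₀ θ₁ h), mul_comm (truncWeight π τ θ₀ θ₂ h),
    mul_smul _ (truncWeight π τ θ₀ θ₁ h), mul_smul _ (truncWeight π τ θ₀ θ₂ h),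
    ← smul_sub, norm_smul, Real.norm_eq_abs]
  refine (mul_le_mul (abs_discounted_reward_le mdp τ h)
    (norm_truncWeight_smul_scoreSum_sub_le hM hG hG0 hM0 τ θ₀ θ₁ θ₂ h) (norm_nonneg _)
    (mul_nonneg (pow_nonneg mdp.discount_pos.le _) mdp.rmax_pos.le)).trans (le_of_eq ?_)
  rw [lipCoeff]
  ring

lemma SmoothPolicy.measurable_scoreSum_comp {π : PolicyClass d S A ν} {M : ℝ}
    (hM : SmoothPolicy π M) {X : Type*} [MeasurableSpace X] {H : ℕ} {f : X → Fin H → S × A}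
    {g : X → EuclideanSpace ℝ (Fin d)} (hf : Measurable f) (hg : Measurable g) (h : Fin H) :
    Measurable (fun x => scoreSum π (f x) (g x) h) :=
  Finset.measurable_sum _ fun z _ => hM.measurable_score_comp hg (measurable_pi_iff.mp hf z)

lemma measurable_reward_comp (mdp : EpisodicMDP S A) {X : Type*} [MeasurableSpace X]
    {f : X → Fin mdp.horizon → S × A} (hf : Measurable f) (h : Fin mdp.horizon) :
    Measurable (fun x => mdp.reward (f x h).1 (f x h).2) :=
  mdp.measurable_reward.comp (measurable_pi_iff.mp hf h)

lemma SmoothPolicy.measurable_gpomdpOff_comp {π : PolicyClass d S A ν} {M : ℝ}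
    (hM : SmoothPolicy π M) (mdp : EpisodicMDP S A) {X : Type*} [MeasurableSpace X]
    {f : X → Fin mdp.horizon → S × A} {g₁ g₂ : X → EuclideanSpace ℝ (Fin d)} (hf : Measurable f)
    (hg₁ : Measurable g₁) (hg₂ : Measurable g₂) :
    Measurable (fun x => gpomdpOff mdp π (f x) (g₁ x) (g₂ x)) := by
  refine Finset.measurable_sum _ fun h _ => ?_
  have h1 := measurable_reward_comp mdp hf h
  have h2 := hM.measurable_scoreSum_comp hf hg₂ h
  have h3 : Measurable (fun x => truncWeight π (f x) (g₁ x) (g₂ x) h) := by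
    refine Finset.measurable_prod _ fun z _ => ?_
    have := measurable_pi_iff.mp hf z
    fun_prop
  fun_prop

lemma SmoothPolicy.measurable_gpomdp_comp {π : PolicyClass d S A ν} {M : ℝ}
    (hM : SmoothPolicy π M) (mdp : EpisodicMDP S A) {X : Type*} [MeasurableSpace X]
    {f : X → Fin mdp.horizon → S × A} {g : X → EuclideanSpace ℝ (Fin d)} (hf : Measurable f)
    (hg : Measurable g) : Measurable (fun x => gpomdp mdp π (f x) (g x)) := by
  simpa only [gpomdpOff_self] using hM.measurable_gpomdpOff_comp mdp hf hg hg

lemma integrable_gpomdpOff (mdp : EpisodicMDP S A) {π : PolicyClass d S A ν} {M G : ℝ}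
    (hM : SmoothPolicy π M) (hG : BoundedScore π G) (hG0 : 0 ≤ G)
    (θ₀ θ₁ : EuclideanSpace ℝ (Fin d)) :
    Integrable (fun τ => gpomdpOff mdp π τ θ₀ θ₁) (trajLaw mdp π θ₀) :=
  Integrable.of_bound (hM.measurable_gpomdpOff_comp mdp measurable_id measurable_const
    measurable_const).aestronglyMeasurable _
    (Filter.Eventually.of_forall fun τ => norm_gpomdpOff_le mdp hM hG hG0 τ θ₀ θ₁)

lemma hasGradientAt_truncWeight {π : PolicyClass d S A ν} {M : ℝ} (hM : SmoothPolicy π M) {H : ℕ}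
    (τ : Fin H → S × A) (θ₀ θ : EuclideanSpace ℝ (Fin d)) (h : Fin H) :
    HasGradientAt (fun ϑ => truncWeight π τ θ₀ ϑ h)
      (truncWeight π τ θ₀ θ h • scoreSum π τ θ h) θ := by
  simp only [truncWeight_eq_exp]
  have h1 : HasFDerivAt (fun ϑ => ∑ z ∈ Finset.Iic h,
      (Real.log (π.dens ϑ (τ z).1 (τ z).2) - Real.log (π.dens θ₀ (τ z).1 (τ z).2)))
      (∑ z ∈ Finset.Iic h, InnerProductSpace.toDual ℝ _ (score π θ (τ z).1 (τ z).2)) θ :=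
    HasFDerivAt.fun_sum fun z _ =>
      (hM.hasGradientAt_log θ (τ z).1 (τ z).2).hasFDerivAt.sub_const _
  rw [hasGradientAt_iff_hasFDerivAt]
  refine h1.exp.congr_fderiv ?_
  rw [map_smulₛₗ, scoreSum, map_sum]
  rfl

-- Since ∇ω = ω ∇ log ω, the off-policy estimator is pathwise the gradient of the
-- importance-weighted return in its target parameter.
lemma hasGradientAt_offReturn (mdp : EpisodicMDP S A) {π : PolicyClass d S A ν} {M : ℝ}
    (hM : SmoothPolicy π M) (τ : Fin mdp.horizon → S × A) (θ₀ θ : EuclideanSpace ℝ (Fin d)) :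
    HasGradientAt (fun ϑ => ∑ h, truncWeight π τ θ₀ ϑ h *
      (mdp.discount ^ (h : ℕ) * mdp.reward (τ h).1 (τ h).2)) (gpomdpOff mdp π τ θ₀ θ) θ := by
  rw [hasGradientAt_iff_hasFDerivAt, gpomdpOff, map_sum]
  refine HasFDerivAt.fun_sum fun h _ => ?_
  refine ((hasGradientAt_truncWeight hM τ θ₀ θ h).hasFDerivAt.mul_const
    (mdp.discount ^ (h : ℕ) * mdp.reward (τ h).1 (τ h).2)).congr_fderiv ?_
  rw [mul_comm (truncWeight π τ θ₀ θ h), map_smulₛₗ, map_smulₛₗ]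
  simp [mul_smul]

lemma measurable_offReturn (mdp : EpisodicMDP S A) (π : PolicyClass d S A ν)
    (θ₀ θ : EuclideanSpace ℝ (Fin d)) :
    Measurable (fun τ : Fin mdp.horizon → S × A => ∑ h, truncWeight π τ θ₀ θ h *
      (mdp.discount ^ (h : ℕ) * mdp.reward (τ h).1 (τ h).2)) := by
  refine Finset.measurable_sum _ fun h _ => ?_
  have := measurable_reward_comp mdp measurable_id h
  simp only [id] at this
  fun_prop

lemma integrable_truncWeight_mul (mdp : EpisodicMDP S A) {π : PolicyClass d S A ν} {M G : ℝ}
    (hM : SmoothPolicy π M) (hG : BoundedScore π G) (θ₀ θ : EuclideanSpace ℝ (Fin d))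
    (h : Fin mdp.horizon) :
    Integrable (fun τ => truncWeight π τ θ₀ θ h *
      (mdp.discount ^ (h : ℕ) * mdp.reward (τ h).1 (τ h).2)) (trajLaw mdp π θ₀) := by
  have hr := measurable_reward_comp mdp measurable_id h
  simp only [id] at hr
  refine Integrable.of_bound (Measurable.aestronglyMeasurable (by fun_prop))
    (Real.exp (((h : ℝ) + 1) * (G * ‖θ - θ₀‖)) * (mdp.discount ^ (h : ℕ) * mdp.rmax))
    (Filter.Eventually.of_forall fun τ => ?_)
  rw [norm_mul, Real.norm_of_nonneg (truncWeight_pos _ _ _ _ _).le]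
  exact mul_le_mul (truncWeight_le hM hG τ θ₀ θ h) (abs_discounted_reward_le mdp τ h)
    (norm_nonneg _) (Real.exp_pos _).le

/-- The objective at `θ` as an expectation over trajectories drawn with `θ₀`. -/
lemma value_eq_integral_offReturn (mdp : EpisodicMDP S A) {π : PolicyClass d S A ν} {M G : ℝ}
    (hM : SmoothPolicy π M) (hG : BoundedScore π G) (θ₀ θ : EuclideanSpace ℝ (Fin d)) :
    value mdp π θ = ∫ τ, ∑ h, truncWeight π τ θ₀ θ h *
      (mdp.discount ^ (h : ℕ) * mdp.reward (τ h).1 (τ h).2) ∂trajLaw mdp π θ₀ := by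
  rw [value_eq_integral, integral_finsetSum _ fun h _ =>
    integrable_truncWeight_mul mdp hM hG θ₀ θ h]
  unfold discountedReturn
  rw [integral_finsetSum]
  · refine Finset.sum_congr rfl fun h _ => ?_
    exact (integral_truncWeight_mul mdp π θ₀ θ h
      (f := fun z => mdp.discount ^ (h : ℕ) * mdp.reward z.1 z.2)
      (mdp.measurable_reward.const_mul _)).symm
  · intro h _
    simpa [truncWeight_self] using integrable_truncWeight_mul mdp hM hG θ θ h

/-- With the sampling law frozen at θ₀, the parameter enters only through the weights, and
differentiation passes under a fixed integral; on a unit ball the weights are bounded by a constant.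
The free θ₀ matters: θ₀ = θ gives unbiasedness of the on-policy estimator, and θ₀ the new iterate
with θ the old one gives the mean of the correction term. -/
theorem hasGradientAt_value (mdp : EpisodicMDP S A) {π : PolicyClass d S A ν} {M G : ℝ}
    (hM : SmoothPolicy π M) (hG : BoundedScore π G) (hG0 : 0 ≤ G)
    (θ₀ θ : EuclideanSpace ℝ (Fin d)) :
    HasGradientAt (value mdp π) (∫ τ, gpomdpOff mdp π τ θ₀ θ ∂trajLaw mdp π θ₀) θ := by
  have h0 : value mdp π = fun ϑ => ∫ τ, ∑ h, truncWeight π τ θ₀ ϑ h *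
      (mdp.discount ^ (h : ℕ) * mdp.reward (τ h).1 (τ h).2) ∂trajLaw mdp π θ₀ :=
    funext fun ϑ => value_eq_integral_offReturn mdp hM hG θ₀ ϑ
  have hint := integrable_gpomdpOff mdp hM hG hG0 θ₀ θ
  have hgb : 0 ≤ gradBound mdp G := by
    have := mdp.discount_pos.le
    have := mdp.rmax_pos.le
    unfold gradBound
    positivity
  have hD := hasFDerivAt_integral_of_dominated_of_fderiv_le (𝕜 := ℝ) (μ := trajLaw mdp π θ₀)
    (x₀ := θ) (s := Metric.ball θ 1)
    (F := fun ϑ τ => ∑ h, truncWeight π τ θ₀ ϑ h *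
      (mdp.discount ^ (h : ℕ) * mdp.reward (τ h).1 (τ h).2))
    (F' := fun ϑ τ => InnerProductSpace.toDual ℝ _ (gpomdpOff mdp π τ θ₀ ϑ))
    (bound := fun _ => Real.exp (mdp.horizon * (G * (1 + ‖θ - θ₀‖))) * gradBound mdp G)
    (Metric.ball_mem_nhds θ one_pos)
    (Filter.Eventually.of_forall fun ϑ => (measurable_offReturn mdp π θ₀ ϑ).aestronglyMeasurable)
    (integrable_finsetSum _ fun h _ => integrable_truncWeight_mul mdp hM hG θ₀ θ h)
    ((InnerProductSpace.toDual ℝ _).continuous.comp_aestronglyMeasurable hint.1)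
    (Filter.Eventually.of_forall fun τ ϑ hϑ => by
      rw [LinearIsometryEquiv.norm_map]
      refine (norm_gpomdpOff_le mdp hM hG hG0 τ θ₀ ϑ).trans
        (mul_le_mul_of_nonneg_right (Real.exp_le_exp.mpr ?_) hgb)
      have h1 : ‖ϑ - θ₀‖ ≤ 1 + ‖θ - θ₀‖ := by
        have h2 := norm_add_le (ϑ - θ) (θ - θ₀)
        rw [sub_add_sub_cancel] at h2
        have h3 := mem_ball_iff_norm.mp hϑ
        linarith
      gcongr)
    (integrable_const _)
    (Filter.Eventually.of_forall fun τ ϑ _ => (hasGradientAt_offReturn mdp hM τ θ₀ ϑ).hasFDerivAt)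
  rw [← h0] at hD
  rw [hasGradientAt_iff_hasFDerivAt]
  refine hD.congr_fderiv ?_
  have hint' : Integrable (fun τ => InnerProductSpace.toDual ℝ (EuclideanSpace ℝ (Fin d))
      (gpomdpOff mdp π τ θ₀ θ)) (trajLaw mdp π θ₀) :=
    ⟨(InnerProductSpace.toDual ℝ _).continuous.comp_aestronglyMeasurable hint.1, by
      simpa [HasFiniteIntegral, enorm, nnnorm] using hint.2⟩
  ext v
  rw [ContinuousLinearMap.integral_apply hint', InnerProductSpace.toDual_apply_apply]
  simp only [InnerProductSpace.toDual_apply_apply]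
  simp_rw [real_inner_comm v]
  exact integral_inner (𝕜 := ℝ) hint v

lemma gradient_value (mdp : EpisodicMDP S A) {π : PolicyClass d S A ν} {M G : ℝ}
    (hM : SmoothPolicy π M) (hG : BoundedScore π G) (hG0 : 0 ≤ G)
    (θ₀ θ : EuclideanSpace ℝ (Fin d)) :
    gradient (value mdp π) θ = ∫ τ, gpomdpOff mdp π τ θ₀ θ ∂trajLaw mdp π θ₀ :=
  (hasGradientAt_value mdp hM hG hG0 θ₀ θ).gradient

lemma gradient_value_eq_integral_gpomdp (mdp : EpisodicMDP S A) {π : PolicyClass d S A ν} {M G : ℝ}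
    (hM : SmoothPolicy π M) (hG : BoundedScore π G) (hG0 : 0 ≤ G)
    (θ : EuclideanSpace ℝ (Fin d)) :
    gradient (value mdp π) θ = ∫ τ, gpomdp mdp π τ θ ∂trajLaw mdp π θ := by
  rw [gradient_value mdp hM hG hG0 θ θ]
  simp only [gpomdpOff_self]

lemma norm_gradient_value_le (mdp : EpisodicMDP S A) {π : PolicyClass d S A ν} {M G : ℝ}
    (hM : SmoothPolicy π M) (hG : BoundedScore π G) (hG0 : 0 ≤ G)
    (θ : EuclideanSpace ℝ (Fin d)) : ‖gradient (value mdp π) θ‖ ≤ gradBound mdp G := by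
  rw [gradient_value_eq_integral_gpomdp mdp hM hG hG0]
  simpa using norm_integral_le_of_norm_le_const (μ := trajLaw mdp π θ)
    (Filter.Eventually.of_forall fun τ => norm_gpomdp_le mdp hM hG hG0 τ θ)

/-! ### Lipschitz bounds in mean and in mean square for the off-policy estimator -/

/-- The sum of the Lipschitz moduli of the summands of the off-policy estimator. -/
noncomputable def lipBound (mdp : EpisodicMDP S A) (M G : ℝ) : ℝ := ∑ h, lipCoeff mdp M G h

lemma lipBound_nonneg (mdp : EpisodicMDP S A) {M G : ℝ} (hM : 0 ≤ M) : 0 ≤ lipBound mdp M G :=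
  Finset.sum_nonneg fun h _ => lipCoeff_nonneg mdp hM h

/-- Letting n tend to infinity removes the exponential factor left by a subdivision into n pieces.
-/
lemma le_of_forall_le_exp_div_mul {y b c : ℝ}
    (h : ∀ n : ℕ, 0 < n → y ≤ Real.exp (c / n) * b) : y ≤ b := by
  have h1 : Filter.Tendsto (fun n : ℕ => Real.exp (c / n) * b) Filter.atTop (nhds b) := by
    have h2 := ((Real.continuous_exp.tendsto 0).comp
      (tendsto_const_div_atTop_nhds_zero_nat c)).mul_const b
    simpa [Function.comp_def] using h2
  refine ge_of_tendsto h1 ?_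
  filter_upwards [Filter.eventually_gt_atTop 0] with n hn using h n hn

/-- The `i`-th of the points dividing the segment from `θ₀` to `θ₁` into `n` equal parts. -/
noncomputable def segPoint (θ₀ θ₁ : EuclideanSpace ℝ (Fin d)) (n i : ℕ) :
    EuclideanSpace ℝ (Fin d) :=
  θ₀ + ((i : ℝ) / n) • (θ₁ - θ₀)

lemma norm_segPoint_sub (θ₀ θ₁ : EuclideanSpace ℝ (Fin d)) (n i : ℕ) :
    ‖segPoint θ₀ θ₁ n i - θ₀‖ = (i : ℝ) / n * ‖θ₁ - θ₀‖ := by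
  rw [segPoint, add_sub_cancel_left, norm_smul, Real.norm_of_nonneg (by positivity)]

lemma norm_segPoint_sub_succ (θ₀ θ₁ : EuclideanSpace ℝ (Fin d)) (n i : ℕ) :
    ‖segPoint θ₀ θ₁ n i - segPoint θ₀ θ₁ n (i + 1)‖ = ‖θ₁ - θ₀‖ / n := by
  have : segPoint θ₀ θ₁ n i - segPoint θ₀ θ₁ n (i + 1) = (-(1 / (n : ℝ))) • (θ₁ - θ₀) := by
    unfold segPoint
    push_cast
    rw [add_div]
    module
  rw [this, norm_smul, norm_neg, Real.norm_of_nonneg (by positivity)]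
  ring

/-- The increments telescope along the segment. A single application of the Lipschitz bound would
cost an exponential in the horizon; n pieces leave only its n-th root and turn the modulus into a
Riemann sum of weights. -/
lemma norm_gpomdpOff_sub_le_sum (mdp : EpisodicMDP S A) {π : PolicyClass d S A ν} {M G : ℝ}
    (hM : SmoothPolicy π M) (hG : BoundedScore π G) (hG0 : 0 ≤ G) (hM0 : 0 ≤ M)
    (τ : Fin mdp.horizon → S × A) (θ₀ θ₁ : EuclideanSpace ℝ (Fin d)) {n : ℕ} (hn : 0 < n) :
    ‖gpomdpOff mdp π τ θ₀ θ₀ - gpomdpOff mdp π τ θ₀ θ₁‖ ≤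
      Real.exp (mdp.horizon * (G * ‖θ₁ - θ₀‖) / n) * (‖θ₁ - θ₀‖ *
        ∑ i ∈ Finset.range n, ∑ h, lipCoeff mdp M G h / n *
          truncWeight π τ θ₀ (segPoint θ₀ θ₁ n i) h) := by
  have hn' : (n : ℝ) ≠ 0 := by positivity
  have h0 : segPoint θ₀ θ₁ n 0 = θ₀ := by simp [segPoint]
  have h1 : segPoint θ₀ θ₁ n n = θ₁ := by simp [segPoint, div_self hn']
  have ht := Finset.sum_range_sub' (fun i => gpomdpOff mdp π τ θ₀ (segPoint θ₀ θ₁ n i)) n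
  rw [h0, h1] at ht
  rw [← ht, Finset.mul_sum, Finset.mul_sum]
  refine norm_sum_le_of_le _ fun i _ => ?_
  refine (norm_gpomdpOff_sub_le mdp hM hG hG0 hM0 τ θ₀ _ _).trans (le_of_eq ?_)
  rw [norm_segPoint_sub_succ]
  have e1 : (mdp.horizon : ℝ) * (G * (‖θ₁ - θ₀‖ / n)) = mdp.horizon * (G * ‖θ₁ - θ₀‖) / n := by ring
  rw [e1, mul_assoc, div_mul_eq_mul_div (‖θ₁ - θ₀‖), mul_div_assoc (‖θ₁ - θ₀‖), Finset.sum_div]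
  simp only [div_mul_eq_mul_div]

lemma integrable_truncWeight (mdp : EpisodicMDP S A) {π : PolicyClass d S A ν} {M G : ℝ}
    (hM : SmoothPolicy π M) (hG : BoundedScore π G) (θ₀ θ : EuclideanSpace ℝ (Fin d))
    (h : Fin mdp.horizon) : Integrable (fun τ => truncWeight π τ θ₀ θ h) (trajLaw mdp π θ₀) :=
  Integrable.of_bound (Measurable.aestronglyMeasurable (by fun_prop)) _
    (Filter.Eventually.of_forall fun τ => by
      rw [Real.norm_of_nonneg (truncWeight_pos _ _ _ _ _).le]
      exact truncWeight_le hM hG τ θ₀ θ h)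

lemma integrable_truncWeight_sq (mdp : EpisodicMDP S A) {π : PolicyClass d S A ν} {M G : ℝ}
    (hM : SmoothPolicy π M) (hG : BoundedScore π G) (θ₀ θ : EuclideanSpace ℝ (Fin d))
    (h : Fin mdp.horizon) :
    Integrable (fun τ => truncWeight π τ θ₀ θ h ^ 2) (trajLaw mdp π θ₀) :=
  Integrable.of_bound (Measurable.aestronglyMeasurable (by fun_prop)) _
    (Filter.Eventually.of_forall fun τ => by
      rw [Real.norm_of_nonneg (sq_nonneg _)]
      exact pow_le_pow_left₀ (truncWeight_pos _ _ _ _ _).le (truncWeight_le hM hG τ θ₀ θ h) 2)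

lemma integral_truncWeight_sq_le (mdp : EpisodicMDP S A) {π : PolicyClass d S A ν} {M G : ℝ}
    (hM : SmoothPolicy π M) (hG : BoundedScore π G) (θ₀ θ : EuclideanSpace ℝ (Fin d))
    (h : Fin mdp.horizon) :
    ∫ τ, truncWeight π τ θ₀ θ h ^ 2 ∂trajLaw mdp π θ₀ ≤
      (2 * Real.cosh (G * ‖θ - θ₀‖) - 1) ^ ((h : ℕ) + 1) := by
  have hc : 0 ≤ 2 * Real.cosh (G * ‖θ - θ₀‖) - 1 := by
    linarith [Real.one_le_cosh (G * ‖θ - θ₀‖)]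
  rw [integral_eq_lintegral_of_nonneg_ae (Filter.Eventually.of_forall fun _ => sq_nonneg _)
    (Measurable.aestronglyMeasurable (by fun_prop))]
  refine ENNReal.toReal_le_of_le_ofReal (by positivity) ?_
  rw [ENNReal.ofReal_pow hc]
  refine lintegral_truncWeight_sq_le mdp π θ₀ θ h fun s => lintegral_ratio_sq_le π θ₀ θ ?_ s
  intro z
  rw [log_ratio]
  exact abs_log_dens_sub_le hM hG θ θ₀ z.1 z.2

/-- The gradient of the objective is Lipschitz. -/
theorem norm_gradient_value_sub_le (mdp : EpisodicMDP S A) {π : PolicyClass d S A ν} {M G : ℝ}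
    (hM : SmoothPolicy π M) (hG : BoundedScore π G) (hG0 : 0 ≤ G) (hM0 : 0 ≤ M)
    (θ₀ θ₁ : EuclideanSpace ℝ (Fin d)) :
    ‖gradient (value mdp π) θ₀ - gradient (value mdp π) θ₁‖ ≤ lipBound mdp M G * ‖θ₁ - θ₀‖ := by
  refine le_of_forall_le_exp_div_mul (c := mdp.horizon * (G * ‖θ₁ - θ₀‖)) fun n hn => ?_
  have hn' : (n : ℝ) ≠ 0 := by positivity
  rw [gradient_value mdp hM hG hG0 θ₀ θ₀, gradient_value mdp hM hG hG0 θ₀ θ₁,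
    ← integral_sub (integrable_gpomdpOff mdp hM hG hG0 θ₀ θ₀)
      (integrable_gpomdpOff mdp hM hG hG0 θ₀ θ₁)]
  have hi : ∀ i ∈ Finset.range n, ∀ h ∈ Finset.univ, Integrable (fun τ => lipCoeff mdp M G h / n *
      truncWeight π τ θ₀ (segPoint θ₀ θ₁ n i) h) (trajLaw mdp π θ₀) :=
    fun i _ h _ => (integrable_truncWeight mdp hM hG θ₀ _ h).const_mul _
  refine (norm_integral_le_of_norm_le (((integrable_finsetSum _ fun i hi' =>
    integrable_finsetSum _ (hi i hi')).const_mul _).const_mul _)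
    (Filter.Eventually.of_forall fun τ =>
      norm_gpomdpOff_sub_le_sum mdp hM hG hG0 hM0 τ θ₀ θ₁ hn)).trans (le_of_eq ?_)
  rw [integral_const_mul, integral_const_mul, integral_finsetSum _ fun i hi' =>
    integrable_finsetSum _ (hi i hi')]
  congr 1
  rw [mul_comm]
  congr 1
  -- Under θ₀ every weight along the segment has mean one, so the Riemann sum integrates exactly to
  -- `lipBound`.
  calc _ = ∑ i ∈ Finset.range n, ∑ h, lipCoeff mdp M G h / n := by
        refine Finset.sum_congr rfl fun i hi' => ?_
        rw [integral_finsetSum _ (hi i hi')]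
        refine Finset.sum_congr rfl fun h _ => ?_
        rw [integral_const_mul, integral_truncWeight, mul_one]
    _ = _ := by
        rw [Finset.sum_const, Finset.card_range, ← Finset.sum_div, nsmul_eq_mul, lipBound]
        field_simp

/-- This is convexity of s ↦ (1 + st)^k, compared with its chord on [0, 1]. It is used with s =
(i/n)². -/
lemma one_add_mul_pow_le {s t : ℝ} (hs0 : 0 ≤ s) (hs1 : s ≤ 1) (ht : 0 ≤ t) (k : ℕ) :
    (1 + s * t) ^ k ≤ 1 + s * ((1 + t) ^ k - 1) := by
  induction k with
  | zero => simp
  | succ k ih =>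
    have h1 : 1 ≤ (1 + t) ^ k := one_le_pow₀ (by linarith)
    have h2 : (1 + s * t) ^ (k + 1) ≤ (1 + s * ((1 + t) ^ k - 1)) * (1 + s * t) := by
      rw [pow_succ]
      exact mul_le_mul_of_nonneg_right ih (by positivity)
    have h3 : 0 ≤ s * (1 - s) * (t * ((1 + t) ^ k - 1)) :=
      mul_nonneg (mul_nonneg hs0 (by linarith)) (mul_nonneg ht (by linarith))
    rw [pow_succ (1 + t)]
    nlinarith

/-- The limit is ∫₀¹ u² du = 1/3, the source of the weights 2/3 and 1/3 in the mean-square bound. -/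
lemma sum_range_sq_div_le {n : ℕ} (hn : 0 < n) :
    ∑ i ∈ Finset.range n, ((i : ℝ) / n) ^ 2 ≤ n / 3 := by
  have h : ∀ m : ℕ, ∑ i ∈ Finset.range m, (i : ℝ) ^ 2 ≤ (m : ℝ) ^ 3 / 3 := by
    intro m
    induction m with
    | zero => simp
    | succ m ih =>
      rw [Finset.sum_range_succ]
      push_cast
      nlinarith [(Nat.cast_nonneg m : (0 : ℝ) ≤ m)]
  have hn' : (0 : ℝ) < n := by positivity
  simp only [div_pow]
  rw [← Finset.sum_div, div_le_iff₀ (by positivity)]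
  refine (h n).trans (le_of_eq ?_)
  ring

/-- Mean-square smoothness of the off-policy estimator. -/
theorem integral_norm_gpomdpOff_sub_sq_le (mdp : EpisodicMDP S A) {π : PolicyClass d S A ν}
    {M G : ℝ} (hM : SmoothPolicy π M) (hG : BoundedScore π G) (hG0 : 0 ≤ G) (hM0 : 0 ≤ M)
    (θ₀ θ₁ : EuclideanSpace ℝ (Fin d)) {t : ℝ} (ht : 0 ≤ t)
    (hcosh : ∀ u : ℝ, 0 ≤ u → u ≤ 1 → 2 * Real.cosh (u * (G * ‖θ₁ - θ₀‖)) - 1 ≤ 1 + u ^ 2 * t) :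
    ∫ τ, ‖gpomdpOff mdp π τ θ₀ θ₀ - gpomdpOff mdp π τ θ₀ θ₁‖ ^ 2 ∂trajLaw mdp π θ₀ ≤
      ‖θ₁ - θ₀‖ ^ 2 * (lipBound mdp M G * (2 / 3 * lipBound mdp M G +
        1 / 3 * ∑ h, lipCoeff mdp M G h * (1 + t) ^ ((h : ℕ) + 1))) := by
  refine le_of_forall_le_exp_div_mul (c := 2 * (mdp.horizon * (G * ‖θ₁ - θ₀‖))) fun n hn => ?_
  have hn0 : (0 : ℝ) < n := by positivity
  set E := Real.exp (2 * (mdp.horizon * (G * ‖θ₁ - θ₀‖)) / n) with hE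
  have hE2 : Real.exp (mdp.horizon * (G * ‖θ₁ - θ₀‖) / n) ^ 2 = E := by
    rw [hE, ← Real.exp_nat_mul]
    congr 1
    push_cast
    ring
  have hlip := lipCoeff_nonneg mdp (G := G) hM0
  have hL : ∑ i ∈ Finset.range n, ∑ h, lipCoeff mdp M G h / n = lipBound mdp M G := by
    rw [Finset.sum_const, Finset.card_range, ← Finset.sum_div, nsmul_eq_mul, lipBound]
    field_simp
  have hi : ∀ i ∈ Finset.range n, ∀ h ∈ Finset.univ, Integrable (fun τ => lipCoeff mdp M G h / n *
      truncWeight π τ θ₀ (segPoint θ₀ θ₁ n i) h ^ 2) (trajLaw mdp π θ₀) :=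
    fun i _ h _ => (integrable_truncWeight_sq mdp hM hG θ₀ _ h).const_mul _
  have hpt : ∀ τ, ‖gpomdpOff mdp π τ θ₀ θ₀ - gpomdpOff mdp π τ θ₀ θ₁‖ ^ 2 ≤
      E * ‖θ₁ - θ₀‖ ^ 2 * lipBound mdp M G * ∑ i ∈ Finset.range n, ∑ h, lipCoeff mdp M G h / n *
          truncWeight π τ θ₀ (segPoint θ₀ θ₁ n i) h ^ 2 := by
    intro τ
    have h1 := pow_le_pow_left₀ (norm_nonneg _)
      (norm_gpomdpOff_sub_le_sum mdp hM hG hG0 hM0 τ θ₀ θ₁ hn) 2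
    refine h1.trans ?_
    rw [mul_pow, mul_pow, hE2, ← mul_assoc, mul_assoc (E * _)]
    refine mul_le_mul_of_nonneg_left ?_ (by positivity)
    rw [← hL]
    simp only [← Finset.sum_product']
    -- Cauchy–Schwarz over the pairs (i, h) with masses `lipCoeff mdp M G h / n`, whose total is
    -- `lipBound`.
    refine Finset.sum_sq_le_sum_mul_sum_of_sq_le_mul _ (fun x _ => ?_) (fun x _ => ?_)
      (fun x _ => ?_)
    · exact div_nonneg (hlip _) hn0.le
    · exact mul_nonneg (div_nonneg (hlip _) hn0.le) (sq_nonneg _)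
    · exact le_of_eq (by ring)
  have hint : ∫ τ, ‖gpomdpOff mdp π τ θ₀ θ₀ - gpomdpOff mdp π τ θ₀ θ₁‖ ^ 2 ∂trajLaw mdp π θ₀ ≤
      ∫ τ, E * ‖θ₁ - θ₀‖ ^ 2 * lipBound mdp M G * ∑ i ∈ Finset.range n, ∑ h,
        lipCoeff mdp M G h / n * truncWeight π τ θ₀ (segPoint θ₀ θ₁ n i) h ^ 2
          ∂trajLaw mdp π θ₀ :=
    integral_mono_of_nonneg (Filter.Eventually.of_forall fun _ => sq_nonneg _)
      ((integrable_finsetSum _ fun i hi' => integrable_finsetSum _ (hi i hi')).const_mul _)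
      (Filter.Eventually.of_forall hpt)
  refine hint.trans ?_
  rw [integral_const_mul, integral_finsetSum _ fun i hi' => integrable_finsetSum _ (hi i hi'),
    mul_assoc E, mul_assoc E, mul_assoc (‖θ₁ - θ₀‖ ^ 2)]
  refine mul_le_mul_of_nonneg_left (mul_le_mul_of_nonneg_left
    (mul_le_mul_of_nonneg_left ?_ (lipBound_nonneg mdp hM0)) (sq_nonneg _)) (Real.exp_pos _).le
  -- The i-th point lies at fraction u = i/n of the segment, so `hcosh` bounds the second moment of
  -- its weight by (1 + u²t)^(h+1), which convexity makes affine in u².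
  calc _ ≤ ∑ i ∈ Finset.range n, ∑ h : Fin mdp.horizon, lipCoeff mdp M G h / n *
        (1 + ((i : ℝ) / n) ^ 2 * ((1 + t) ^ ((h : ℕ) + 1) - 1)) := by
        refine Finset.sum_le_sum fun i hi' => ?_
        rw [integral_finsetSum _ (hi i hi')]
        refine Finset.sum_le_sum fun h _ => ?_
        rw [integral_const_mul]
        refine mul_le_mul_of_nonneg_left ?_ (div_nonneg (hlip h) hn0.le)
        refine (integral_truncWeight_sq_le mdp hM hG θ₀ _ h).trans ?_
        have hu0 : 0 ≤ (i : ℝ) / n := by positivity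
        have hu1 : (i : ℝ) / n ≤ 1 := by
          rw [div_le_one hn0]
          exact_mod_cast (Finset.mem_range.mp hi').le
        have h1 := hcosh _ hu0 hu1
        rw [norm_segPoint_sub, mul_left_comm]
        refine (pow_le_pow_left₀ ?_ h1 _).trans
          (one_add_mul_pow_le (sq_nonneg _) (pow_le_one₀ hu0 hu1) ht _)
        linarith [Real.one_le_cosh ((i : ℝ) / n * (G * ‖θ₁ - θ₀‖))]
    _ = ∑ h : Fin mdp.horizon, lipCoeff mdp M G h *
        (1 + ((1 + t) ^ ((h : ℕ) + 1) - 1) *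
          ((∑ i ∈ Finset.range n, ((i : ℝ) / n) ^ 2) / n)) := by
        rw [Finset.sum_comm]
        refine Finset.sum_congr rfl fun h _ => ?_
        rw [← Finset.mul_sum, Finset.sum_add_distrib, ← Finset.sum_mul, Finset.sum_const,
          Finset.card_range, nsmul_eq_mul, mul_one]
        field_simp
    _ ≤ ∑ h : Fin mdp.horizon, lipCoeff mdp M G h *
        (1 + ((1 + t) ^ ((h : ℕ) + 1) - 1) * (1 / 3)) := by
        refine Finset.sum_le_sum fun h _ => mul_le_mul_of_nonneg_left ?_ (hlip h)
        have h1 : 1 ≤ (1 + t) ^ ((h : ℕ) + 1) := one_le_pow₀ (by linarith)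
        have h2 : (∑ i ∈ Finset.range n, ((i : ℝ) / n) ^ 2) / n ≤ 1 / 3 := by
          rw [div_le_iff₀ hn0]
          linarith [sum_range_sq_div_le hn]
        have := mul_le_mul_of_nonneg_left h2 (sub_nonneg.mpr h1)
        linarith
    _ = _ := by
        rw [lipBound, Finset.mul_sum, Finset.mul_sum, ← Finset.sum_add_distrib]
        refine Finset.sum_congr rfl fun h _ => ?_
        ring

/-! ### Numerical bounds -/
-- This is condition `hp` of `integral_norm_gpomdpOff_sub_sq_le_const` for k = 2 and c = 1.41, with
-- a = 1 − γ.
lemma one_add_le_four_mul_sq {a : ℝ} (h0 : 0 < a) (h1 : a < 1) :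
    1 + 1.41 * a ^ 2 ≤ 4 * (1 - 1.41 * a * (1 - a)) ^ 2 := by
  have h2 : 0 ≤ a * (1 - a) := mul_nonneg h0.le (by linarith)
  nlinarith [sq_nonneg (a - 0.6), sq_nonneg (a * (a - 0.6)), mul_nonneg h2 h2, mul_nonneg h2 h0.le,
    mul_nonneg h2 (sq_nonneg (a - 0.6))]

lemma one_add_le_ten_mul_sq {a : ℝ} (h0 : 0 < a) (h1 : a < 1) :
    1 + 1.89 * a ^ 2 ≤ 10 * (1 - 1.89 * a * (1 - a)) ^ 2 := by
  have h2 : 0 ≤ a * (1 - a) := mul_nonneg h0.le (by linarith)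
  nlinarith [sq_nonneg (a - 0.6), sq_nonneg (a * (a - 0.6)), mul_nonneg h2 h2, mul_nonneg h2 h0.le,
    mul_nonneg h2 (sq_nonneg (a - 0.6))]

lemma tangent_le_cube {y y0 : ℝ} (hy : 0 ≤ y) (hy0 : 0 ≤ y0) :
    3 * y0 ^ 2 * y - 2 * y0 ^ 3 ≤ y ^ 3 := by
  nlinarith [mul_nonneg hy (sq_nonneg (y - y0)), mul_nonneg hy0 (sq_nonneg (y - y0))]

/-- This is condition `hq` for k = 2. Replacing the cube by a tangent lowers the degree; the point
0.65 is close to 0.6475, the minimum of 1 − 1.41a(1 − a). -/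
lemma mul_one_add_le_eight_mul_cube {a : ℝ} (h0 : 0 < a) (h1 : a < 1) :
    (1 + 1.41 * a ^ 2) * (1 + (1 - a) * (1 + 1.41 * a ^ 2)) ≤
      (8 + 2 * a) * (1 - 1.41 * a * (1 - a)) ^ 3 := by
  have h2 : 0 ≤ a * (1 - a) := mul_nonneg h0.le (by linarith)
  have ht := tangent_le_cube (y := 1 - 1.41 * a * (1 - a)) (y0 := 0.65)
      (by nlinarith [sq_nonneg (a - 0.5)]) (by norm_num)
  refine le_trans ?_ (mul_le_mul_of_nonneg_left ht (by linarith))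
  have h3 := mul_nonneg h0.le (sq_nonneg (a - 0.55))
  have h4 := mul_nonneg (sub_nonneg.2 h1.le) (sq_nonneg (a - 0.55))
  nlinarith [h3, h4, mul_nonneg h2 h3, mul_nonneg h2 h4, mul_nonneg h0.le h3,
    mul_nonneg h0.le (mul_nonneg h0.le h3), mul_nonneg h2 h2, mul_nonneg h2 (mul_nonneg h0.le h2)]

lemma mul_one_add_le_twenty_mul_cube {a : ℝ} (h0 : 0 < a) (h1 : a < 1) :
    (1 + 1.89 * a ^ 2) * (1 + (1 - a) * (1 + 1.89 * a ^ 2)) ≤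
      (20 + 2 * a) * (1 - 1.89 * a * (1 - a)) ^ 3 := by
  have h2 : 0 ≤ a * (1 - a) := mul_nonneg h0.le (by linarith)
  -- The minimum of 1 − 1.89a(1 − a), at a = 1/2, is 0.5275.
  have ht := tangent_le_cube (y := 1 - 1.89 * a * (1 - a)) (y0 := 0.53)
      (by nlinarith [sq_nonneg (a - 0.5)]) (by norm_num)
  refine le_trans ?_ (mul_le_mul_of_nonneg_left ht (by linarith))
  have h3 := mul_nonneg h0.le (sq_nonneg (a - 0.55))
  have h4 := mul_nonneg (sub_nonneg.2 h1.le) (sq_nonneg (a - 0.55))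
  nlinarith [h3, h4, mul_nonneg h2 h3, mul_nonneg h2 h4, mul_nonneg h0.le h3,
    mul_nonneg h0.le (mul_nonneg h0.le h3), mul_nonneg h2 h2, mul_nonneg h2 (mul_nonneg h0.le h2)]

/-- The left side is 1 + 4 sinh²(z/2). A Taylor bound gives sinh y ≤ 1.0715 y for y ≤ 0.6405, and
1.0715² < 1.15. -/
lemma two_mul_cosh_sub_one_le {z : ℝ} (h0 : 0 ≤ z) (h1 : z ≤ 1.281) :
    2 * Real.cosh z - 1 ≤ 1 + 1.15 * z ^ 2 := by
  obtain ⟨y, rfl⟩ : ∃ y, z = 2 * y := ⟨z / 2, by ring⟩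
  have hy0 : 0 ≤ y := by linarith
  have hy1 : y ≤ 0.6405 := by linarith
  have e1 := (abs_le.mp (Real.exp_bound (x := y) (n := 5)
      (by rw [abs_of_nonneg hy0]; linarith) (by norm_num))).2
  have e2 := (abs_le.mp (Real.exp_bound (x := -y) (n := 5)
      (by rw [abs_neg, abs_of_nonneg hy0]; linarith) (by norm_num))).1
  rw [abs_neg] at e2
  rw [abs_of_nonneg hy0] at e1 e2
  norm_num [Finset.sum_range_succ, Nat.factorial] at e1 e2
  have hs : Real.sinh y ≤ y * 1.0715 := by
    rw [Real.sinh_eq]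
    have hy2 : y ^ 2 ≤ 0.4104 := by nlinarith
    have : y ^ 4 ≤ 0.1685 := by nlinarith
    nlinarith
  have hs0 : 0 ≤ Real.sinh y := Real.sinh_nonneg_iff.mpr hy0
  rw [Real.cosh_two_mul, Real.cosh_sq]
  nlinarith

lemma sum_succ_mul_pow_le {q : ℝ} (h0 : 0 ≤ q) (h1 : q ≤ 1) (H : ℕ) :
    (1 - q) ^ 2 * ∑ h ∈ Finset.range H, ((h : ℝ) + 1) * q ^ h ≤ 1 := by
  have key : (1 - q) ^ 2 * ∑ h ∈ Finset.range H, ((h : ℝ) + 1) * q ^ h =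
      1 - q ^ H * (1 + H * (1 - q)) := by
    induction H with
    | zero => simp
    | succ H ih =>
      rw [Finset.sum_range_succ, mul_add, ih]
      push_cast
      ring
  have : 0 ≤ 1 - q := by linarith
  have : 0 ≤ q ^ H * (1 + H * (1 - q)) := by positivity
  linarith

lemma sum_succ_sq_mul_pow_le {q : ℝ} (h0 : 0 ≤ q) (h1 : q ≤ 1) (H : ℕ) :
    (1 - q) ^ 3 * ∑ h ∈ Finset.range H, ((h : ℝ) + 1) ^ 2 * q ^ h ≤ 1 + q := by
  have key : (1 - q) ^ 3 * ∑ h ∈ Finset.range H, ((h : ℝ) + 1) ^ 2 * q ^ h =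
      1 + q - q ^ H * (H ^ 2 * (1 - q) ^ 2 + 2 * H * (1 - q) + 1 + q) := by
    induction H with
    | zero => simp
    | succ H ih =>
      rw [Finset.sum_range_succ, mul_add, ih]
      push_cast
      ring
  have : 0 ≤ 1 - q := by linarith
  have : 0 ≤ q ^ H * (H ^ 2 * (1 - q) ^ 2 + 2 * H * (1 - q) + 1 + q) := by positivity
  linarith

/-! ### Horizon-free bounds for the constants of the estimator -/

lemma gradBound_le (mdp : EpisodicMDP S A) {G : ℝ} (hG0 : 0 ≤ G) :
    gradBound mdp G ≤ mdp.rmax * G / (1 - mdp.discount) ^ 2 := by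
  have h1 := mdp.discount_lt_one
  have hr := mdp.rmax_pos.le
  have hs := sum_succ_mul_pow_le mdp.discount_pos.le h1.le mdp.horizon
  have h2 : gradBound mdp G = mdp.rmax * G *
      ∑ h ∈ Finset.range mdp.horizon, ((h : ℝ) + 1) * mdp.discount ^ h := by
    rw [gradBound, Fin.sum_univ_eq_sum_range
      (fun h => mdp.discount ^ h * mdp.rmax * (((h : ℝ) + 1) * G)), Finset.mul_sum]
    exact Finset.sum_congr rfl fun h _ => by ring
  have h3 : 0 < 1 - mdp.discount := by linarith
  rw [h2, le_div_iff₀ (by positivity)]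
  have := mul_le_mul_of_nonneg_left hs (mul_nonneg hr hG0)
  linarith

/-- Weighting by κ^(h+1) with κ = 1 + ca² replaces the ratio γ = 1 − a by ρ = γκ, and 1 − ρ = a·y
with y = 1 − ca(1 − a). The sums of (h+1)ρ^h and (h+1)²ρ^h are at most 1/(ay)² and (1 + ρ)/(ay)³;
`hp` and `hq` let p and q absorb the powers of y and the extra κ. Here p is not the switching
probability. -/
lemma sum_lipCoeff_mul_pow_le (mdp : EpisodicMDP S A) {M G a c p q : ℝ} (hM0 : 0 ≤ M)
    (ha : a = 1 - mdp.discount) (hc : 0 ≤ c) (hy : 0 < 1 - c * a * (1 - a))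
    (hp : 1 + c * a ^ 2 ≤ p * (1 - c * a * (1 - a)) ^ 2)
    (hq : (1 + c * a ^ 2) * (1 + (1 - a) * (1 + c * a ^ 2)) ≤
      q * (1 - c * a * (1 - a)) ^ 3) :
    ∑ h, lipCoeff mdp M G h * (1 + c * a ^ 2) ^ ((h : ℕ) + 1) ≤
      mdp.rmax * (p * (M / a ^ 2) + q * (G ^ 2 / a ^ 3)) := by
  have hγ0 := mdp.discount_pos
  have hγ1 := mdp.discount_lt_one
  have hr := mdp.rmax_pos.le
  have hγ : mdp.discount = 1 - a := by linarith
  have ha0 : 0 < a := by linarith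
  have ha1 : 0 < 1 - a := by linarith
  clear ha
  set κ := 1 + c * a ^ 2 with hκ
  set y := 1 - c * a * (1 - a) with hyd
  have hκ0 : 0 < κ := by positivity
  set ρ := (1 - a) * κ with hρ
  have hρ0 : 0 < ρ := by positivity
  have hb : 1 - ρ = a * y := by rw [hρ, hκ, hyd]; ring
  have hρ1 : ρ ≤ 1 := by
    have : 0 < a * y := by positivity
    linarith
  have hs1 := sum_succ_mul_pow_le hρ0.le hρ1 mdp.horizon
  have hs2 := sum_succ_sq_mul_pow_le hρ0.le hρ1 mdp.horizon
  set s1 := ∑ h ∈ Finset.range mdp.horizon, ((h : ℝ) + 1) * ρ ^ h with hs1d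
  set s2 := ∑ h ∈ Finset.range mdp.horizon, ((h : ℝ) + 1) ^ 2 * ρ ^ h with hs2d
  have hs1p : 0 ≤ s1 := by positivity
  have hs2p : 0 ≤ s2 := by positivity
  have e : ∑ h, lipCoeff mdp M G h * κ ^ ((h : ℕ) + 1) =
      mdp.rmax * (M * (κ * s1) + G ^ 2 * (κ * s2)) := by
    simp only [lipCoeff]
    rw [Fin.sum_univ_eq_sum_range (fun h => mdp.discount ^ h * mdp.rmax *
      (((h : ℝ) + 1) * M + ((h : ℝ) + 1) ^ 2 * G ^ 2) * κ ^ (h + 1)), hs1d, hs2d]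
    simp only [Finset.mul_sum, ← Finset.sum_add_distrib]
    refine Finset.sum_congr rfl fun h _ => ?_
    rw [hρ, hγ, mul_pow]
    ring
  have hp0 : 0 ≤ p := by
    by_contra hneg
    nlinarith [sq_nonneg y, mul_nonneg (sub_nonneg.mpr (not_le.mp hneg).le) (sq_nonneg y)]
  have hq0 : 0 ≤ q := by
    by_contra hneg
    have h1 : 0 < y ^ 3 := by positivity
    have h2 : 0 < κ * (1 + ρ) := by positivity
    nlinarith [mul_nonneg (sub_nonneg.mpr (not_le.mp hneg).le) h1.le]
  have b1 : κ * s1 ≤ p / a ^ 2 := by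
    rw [le_div_iff₀ (by positivity)]
    rw [hb] at hs1
    calc κ * s1 * a ^ 2 ≤ p * y ^ 2 * s1 * a ^ 2 := by gcongr
      _ = p * ((a * y) ^ 2 * s1) := by ring
      _ ≤ p * 1 := by gcongr
      _ = p := mul_one p
  have b2 : κ * s2 ≤ q / a ^ 3 := by
    rw [le_div_iff₀ (by positivity)]
    rw [hb] at hs2
    refine le_of_mul_le_mul_right ?_ (show 0 < 1 + ρ by positivity)
    calc κ * s2 * a ^ 3 * (1 + ρ) = κ * (1 + ρ) * s2 * a ^ 3 := by ring
      _ ≤ q * y ^ 3 * s2 * a ^ 3 := by gcongr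
      _ = q * ((a * y) ^ 3 * s2) := by ring
      _ ≤ q * (1 + ρ) := by gcongr
  rw [e]
  refine mul_le_mul_of_nonneg_left ?_ hr
  calc M * (κ * s1) + G ^ 2 * (κ * s2) ≤ M * (p / a ^ 2) + G ^ 2 * (q / a ^ 3) := by gcongr
    _ = _ := by ring

/-- The case c = 0. Keeping 2 − a instead of 2 leaves slack against `constL`, which reappears as the
term 2a in later numerical conditions. -/
lemma lipBound_le (mdp : EpisodicMDP S A) {M G a : ℝ} (hM0 : 0 ≤ M)
    (ha : a = 1 - mdp.discount) :
    lipBound mdp M G ≤ mdp.rmax * (M / a ^ 2 + (2 - a) * (G ^ 2 / a ^ 3)) := by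
  have h := sum_lipCoeff_mul_pow_le mdp (M := M) (G := G) (c := 0) (p := 1) (q := 2 - a) hM0 ha
    le_rfl (by simp) (by simp) (by simp; linarith)
  simpa [lipBound] using h

lemma constL_eq (R γ G M : ℝ) :
    constL R γ G M = R * (M / (1 - γ) ^ 2 + 2 * (G ^ 2 / (1 - γ) ^ 3)) := by
  rw [constL]
  ring

lemma lipBound_le_constL (mdp : EpisodicMDP S A) {M G : ℝ} (hM0 : 0 ≤ M) :
    lipBound mdp M G ≤ constL mdp.rmax mdp.discount G M := by
  have h1 := mdp.discount_lt_one
  have hr := mdp.rmax_pos.le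
  have ha : 0 < 1 - mdp.discount := by linarith
  refine (lipBound_le mdp hM0 rfl).trans ?_
  rw [constL_eq]
  gcongr
  linarith

/-- Mean-square smoothness of the off-policy estimator for parameters at distance at most
`z (1 - γ) / G`, where `z` is controlled through the numerical hypotheses. -/
lemma integral_norm_gpomdpOff_sub_sq_le_const (mdp : EpisodicMDP S A) {π : PolicyClass d S A ν}
    {M G a c z k : ℝ} (hM : SmoothPolicy π M) (hG : BoundedScore π G) (hG0 : 0 ≤ G) (hM0 : 0 ≤ M)
    (ha : a = 1 - mdp.discount) (hc : 0 ≤ c) (hc4 : c < 4)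
    (hz1 : z ≤ 1.281) (hzc : 1.15 * z ^ 2 ≤ c)
    (hp : 1 + c * a ^ 2 ≤ (3 * k - 2) * (1 - c * a * (1 - a)) ^ 2)
    (hq : (1 + c * a ^ 2) * (1 + (1 - a) * (1 + c * a ^ 2)) ≤
      (6 * k - 4 + 2 * a) * (1 - c * a * (1 - a)) ^ 3)
    (θ₀ θ₁ : EuclideanSpace ℝ (Fin d)) (hx : G * ‖θ₁ - θ₀‖ ≤ z * a) :
    ∫ τ, ‖gpomdpOff mdp π τ θ₀ θ₀ - gpomdpOff mdp π τ θ₀ θ₁‖ ^ 2 ∂trajLaw mdp π θ₀ ≤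
      ‖θ₁ - θ₀‖ ^ 2 * (k * constL mdp.rmax mdp.discount G M ^ 2) := by
  have h1 := mdp.discount_lt_one
  have h0 := mdp.discount_pos
  have hr := mdp.rmax_pos.le
  have ha0 : 0 < a := by linarith
  have ha1 : a < 1 := by linarith
  have hx0 : 0 ≤ G * ‖θ₁ - θ₀‖ := by positivity
  have hz0 : 0 ≤ z := by
    by_contra hneg
    nlinarith
  have hza : z * a ≤ 1.281 := by nlinarith
  have hy : 0 < 1 - c * a * (1 - a) := by nlinarith [sq_nonneg (a - 1 / 2)]
  refine (integral_norm_gpomdpOff_sub_sq_le mdp hM hG hG0 hM0 θ₀ θ₁ (t := c * a ^ 2)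
    (by positivity) fun u hu0 hu1 => ?_).trans ?_
  · have hux : u * (G * ‖θ₁ - θ₀‖) ≤ G * ‖θ₁ - θ₀‖ := mul_le_of_le_one_left hx0 hu1
    refine (two_mul_cosh_sub_one_le (by positivity) (by linarith)).trans ?_
    have e1 : (G * ‖θ₁ - θ₀‖) ^ 2 ≤ (z * a) ^ 2 := pow_le_pow_left₀ hx0 hx 2
    have e2 : 1.15 * (G * ‖θ₁ - θ₀‖) ^ 2 ≤ c * a ^ 2 := by nlinarith [sq_nonneg a]
    rw [mul_pow]
    nlinarith [sq_nonneg u]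
  · refine mul_le_mul_of_nonneg_left ?_ (sq_nonneg _)
    have b1 := lipBound_le mdp (G := G) hM0 ha
    have b2 := sum_lipCoeff_mul_pow_le mdp (G := G) hM0 ha hc hy hp hq
    have b3 := lipBound_le_constL mdp (G := G) hM0
    have hL0 := lipBound_nonneg mdp (G := G) hM0
    -- The hypotheses are shaped for this sum: (2 + (3k − 2))/3 = k on the M-term and (2(2 − a) +
    -- (6k − 4 + 2a))/3 = 2k on the G²-term.
    have hsum : 2 / 3 * lipBound mdp M G +
        1 / 3 * ∑ h, lipCoeff mdp M G h * (1 + c * a ^ 2) ^ ((h : ℕ) + 1) ≤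
        k * constL mdp.rmax mdp.discount G M := by
      rw [constL_eq, ← ha]
      refine (add_le_add (mul_le_mul_of_nonneg_left b1 (by norm_num))
        (mul_le_mul_of_nonneg_left b2 (by norm_num))).trans (le_of_eq ?_)
      ring
    have hnn : 0 ≤ 2 / 3 * lipBound mdp M G +
        1 / 3 * ∑ h, lipCoeff mdp M G h * (1 + c * a ^ 2) ^ ((h : ℕ) + 1) := by
      have : 0 ≤ ∑ h, lipCoeff mdp M G h * (1 + c * a ^ 2) ^ ((h : ℕ) + 1) :=
        Finset.sum_nonneg fun h _ => mul_nonneg (lipCoeff_nonneg mdp hM0 h) (by positivity)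
      positivity
    calc _ ≤ constL mdp.rmax mdp.discount G M * (k * constL mdp.rmax mdp.discount G M) :=
          mul_le_mul b3 hsum hnn (hL0.trans b3)
      _ = _ := by ring

/-- The radius 1.104 covers the steps that occur for p ≤ 2/3; c = 1.41 suffices since 1.15 · 1.104²
< 1.41. -/
lemma integral_norm_gpomdpOff_sub_sq_le_two (mdp : EpisodicMDP S A) {π : PolicyClass d S A ν}
    {M G : ℝ} (hM : SmoothPolicy π M) (hG : BoundedScore π G) (hG0 : 0 ≤ G) (hM0 : 0 ≤ M)
    (θ₀ θ₁ : EuclideanSpace ℝ (Fin d)) (hx : G * ‖θ₁ - θ₀‖ ≤ 1.104 * (1 - mdp.discount)) :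
    ∫ τ, ‖gpomdpOff mdp π τ θ₀ θ₀ - gpomdpOff mdp π τ θ₀ θ₁‖ ^ 2 ∂trajLaw mdp π θ₀ ≤
      ‖θ₁ - θ₀‖ ^ 2 * (2 * constL mdp.rmax mdp.discount G M ^ 2) := by
  have h0 : 0 < 1 - mdp.discount := by linarith [mdp.discount_lt_one]
  have h1 : 1 - mdp.discount < 1 := by linarith [mdp.discount_pos]
  refine integral_norm_gpomdpOff_sub_sq_le_const mdp hM hG hG0 hM0 rfl (c := 1.41) (by norm_num)
    (by norm_num) (by norm_num) (by norm_num) ?_ ?_ θ₀ θ₁ hx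
  · convert one_add_le_four_mul_sq h0 h1 using 2
    norm_num
  · convert mul_one_add_le_eight_mul_cube h0 h1 using 3
    norm_num

/-- A larger radius, covering every p ≤ 1, at the price of doubling the constant; 1.15 · 1.281² <
1.89. -/
lemma integral_norm_gpomdpOff_sub_sq_le_four (mdp : EpisodicMDP S A) {π : PolicyClass d S A ν}
    {M G : ℝ} (hM : SmoothPolicy π M) (hG : BoundedScore π G) (hG0 : 0 ≤ G) (hM0 : 0 ≤ M)
    (θ₀ θ₁ : EuclideanSpace ℝ (Fin d)) (hx : G * ‖θ₁ - θ₀‖ ≤ 1.281 * (1 - mdp.discount)) :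
    ∫ τ, ‖gpomdpOff mdp π τ θ₀ θ₀ - gpomdpOff mdp π τ θ₀ θ₁‖ ^ 2 ∂trajLaw mdp π θ₀ ≤
      ‖θ₁ - θ₀‖ ^ 2 * (4 * constL mdp.rmax mdp.discount G M ^ 2) := by
  have h0 : 0 < 1 - mdp.discount := by linarith [mdp.discount_lt_one]
  have h1 : 1 - mdp.discount < 1 := by linarith [mdp.discount_pos]
  refine integral_norm_gpomdpOff_sub_sq_le_const mdp hM hG hG0 hM0 rfl (c := 1.89) (by norm_num)
    (by norm_num) (by norm_num) (by norm_num) ?_ ?_ θ₀ θ₁ hx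
  · convert one_add_le_ten_mul_sq h0 h1 using 2
    norm_num
  · convert mul_one_add_le_twenty_mul_cube h0 h1 using 3
    norm_num

/-! ### Averages over independent samples -/

/-- Independent centred samples are orthogonal to each other and to the constant e. With e = 0 this
is the large-batch variance; with e the old error it is the small-batch recursion. -/
lemma integral_norm_add_average_sub_sq {Ω E : Type*} [MeasurableSpace Ω]
    [NormedAddCommGroup E] [InnerProductSpace ℝ E] [CompleteSpace E] [MeasurableSpace E]
    [BorelSpace E] [SecondCountableTopology E]
    (μ : Measure Ω) [IsProbabilityMeasure μ] {X : Ω → E} (hX : Measurable X) {C : ℝ}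
    (hC : ∀ ω, ‖X ω‖ ≤ C) {n : ℕ} (hn : 0 < n) (e : E) :
    ∫ ω : Fin n → Ω, ‖e + ((1 / (n : ℝ)) • ∑ i, X (ω i) - ∫ ω', X ω' ∂μ)‖ ^ 2
        ∂Measure.pi (fun _ => μ) =
      ‖e‖ ^ 2 + 1 / (n : ℝ) * ∫ ω, ‖X ω - ∫ ω', X ω' ∂μ‖ ^ 2 ∂μ := by
  have hXi : Integrable X μ :=
    Integrable.of_bound hX.aestronglyMeasurable C (Filter.Eventually.of_forall hC)
  set m := ∫ ω', X ω' ∂μ with hm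
  set Y : Ω → E := fun ω => X ω - m with hY
  have hYm : Measurable Y := hX.sub_const m
  have hYC : ∀ ω, ‖Y ω‖ ≤ C + ‖m‖ := fun ω =>
    (norm_sub_le _ _).trans (add_le_add (hC ω) le_rfl)
  have hYi : Integrable Y μ := hXi.sub (integrable_const m)
  have hY0 : ∫ ω, Y ω ∂μ = 0 := by
    rw [hY, integral_sub hXi (integrable_const m)]
    simp [hm]
  have hn' : (n : ℝ) ≠ 0 := by positivity
  set P : Measure (Fin n → Ω) := Measure.pi (fun _ => μ) with hP
  have hYie : ∀ i, Integrable (fun ω : Fin n → Ω => Y (ω i)) P := fun i =>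
    integrable_comp_eval (μ := fun _ : Fin n => μ) hYi
  have hind : iIndepFun (fun i (ω : Fin n → Ω) => Y (ω i)) P :=
    iIndepFun_pi (μ := fun _ : Fin n => μ) (X := fun _ => Y) fun _ => hYm.aemeasurable
  have hcross : ∀ i j, i ≠ j → ∫ ω, inner ℝ (Y (ω i)) (Y (ω j)) ∂P = 0 := by
    intro i j hij
    have h1 : ∫ ω, inner ℝ (Y (ω i)) (Y (ω j)) ∂P =
        inner ℝ (∫ ω, Y (ω i) ∂P) (∫ ω, Y (ω j) ∂P) :=
      (hind.indepFun hij).integral_bilin (hYie i) (hYie j) (innerSL ℝ)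
    rw [h1, integral_comp_eval (μ := fun _ : Fin n => μ) hYm.aestronglyMeasurable, hY0]
    simp
  have hintIJ : ∀ i j, Integrable (fun ω : Fin n → Ω => (inner ℝ (Y (ω i)) (Y (ω j)) : ℝ)) P := by
    intro i j
    refine Integrable.of_bound (Measurable.aestronglyMeasurable
      ((hYm.comp (measurable_pi_apply i)).inner (hYm.comp (measurable_pi_apply j))))
      ((C + ‖m‖) * (C + ‖m‖)) (Filter.Eventually.of_forall fun ω => ?_)
    refine (norm_inner_le_norm _ _).trans (mul_le_mul (hYC _) (hYC _) (norm_nonneg _) ?_)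
    exact (norm_nonneg _).trans (hYC (ω i))
  have hpt : ∀ ω : Fin n → Ω, ‖e + ((1 / (n : ℝ)) • ∑ i, X (ω i) - m)‖ ^ 2 =
      ‖e‖ ^ 2 + 2 * (1 / (n : ℝ)) * ∑ i, inner ℝ e (Y (ω i)) +
        (1 / (n : ℝ)) ^ 2 * ∑ i, ∑ j, inner ℝ (Y (ω i)) (Y (ω j)) := by
    intro ω
    have h1 : (1 / (n : ℝ)) • ∑ i, X (ω i) - m = (1 / (n : ℝ)) • ∑ i, Y (ω i) := by
      rw [hY, Finset.sum_sub_distrib, smul_sub, Finset.sum_const, Finset.card_univ,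
        Fintype.card_fin, ← Nat.cast_smul_eq_nsmul ℝ, smul_smul, one_div_mul_cancel hn', one_smul]
    rw [h1, norm_add_sq_real, inner_smul_right, inner_sum, norm_smul, mul_pow,
      ← real_inner_self_eq_norm_sq (∑ i, Y (ω i)), sum_inner]
    simp only [inner_sum, Real.norm_eq_abs, sq_abs]
    ring
  simp only [hpt]
  have hlin : ∀ i, Integrable (fun ω : Fin n → Ω => (inner ℝ e (Y (ω i)) : ℝ)) P :=
    fun i => (hYie i).const_inner e
  have hdiag : ∀ i, ∑ j, ∫ ω, inner ℝ (Y (ω i)) (Y (ω j)) ∂P = ∫ ω, ‖Y ω‖ ^ 2 ∂μ := by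
    intro i
    rw [Finset.sum_eq_single i (fun j _ hji => hcross i j hji.symm) (by simp)]
    simp only [real_inner_self_eq_norm_sq]
    exact integral_comp_eval (μ := fun _ : Fin n => μ) (f := fun ω => ‖Y ω‖ ^ 2)
      (hYm.norm.pow_const 2).aestronglyMeasurable
  have hfst : Integrable (fun ω : Fin n → Ω =>
      ‖e‖ ^ 2 + 2 * (1 / (n : ℝ)) * ∑ i, inner ℝ e (Y (ω i))) P :=
    (integrable_const _).add ((integrable_finsetSum _ fun i _ => hlin i).const_mul _)
  rw [integral_add hfst ((integrable_finsetSum _ fun i _ => integrable_finsetSum _ fun j _ =>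
    hintIJ i j).const_mul _),
    integral_add (integrable_const _) ((integrable_finsetSum _ fun i _ => hlin i).const_mul _),
    integral_const_mul, integral_const_mul, integral_finsetSum _ fun i _ => hlin i,
    integral_finsetSum _ fun i _ => integrable_finsetSum _ fun j _ => hintIJ i j]
  have h1 : ∀ i, ∫ ω, inner ℝ e (Y (ω i)) ∂P = 0 := by
    intro i
    rw [integral_inner (hYie i), integral_comp_eval (μ := fun _ : Fin n => μ)
      hYm.aestronglyMeasurable, hY0, inner_zero_right]
  have h2 : ∀ i, ∫ ω, ∑ j, inner ℝ (Y (ω i)) (Y (ω j)) ∂P = ∫ ω, ‖Y ω‖ ^ 2 ∂μ := by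
    intro i
    rw [integral_finsetSum _ fun j _ => hintIJ i j, hdiag i]
  simp only [h1, h2, Finset.sum_const, Finset.card_univ, Fintype.card_fin, nsmul_eq_mul,
    integral_const, probReal_univ, smul_eq_mul]
  field_simp
  ring

lemma integral_norm_sub_integral_sq_le {Ω E : Type*} [MeasurableSpace Ω]
    [NormedAddCommGroup E] [InnerProductSpace ℝ E] [CompleteSpace E]
    (μ : Measure Ω) [IsProbabilityMeasure μ] {X : Ω → E} (hX : AEStronglyMeasurable X μ) {C : ℝ}
    (hC : ∀ ω, ‖X ω‖ ≤ C) :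
    ∫ ω, ‖X ω - ∫ ω', X ω' ∂μ‖ ^ 2 ∂μ ≤ ∫ ω, ‖X ω‖ ^ 2 ∂μ := by
  have hXi : Integrable X μ := Integrable.of_bound hX C (Filter.Eventually.of_forall hC)
  have hXsq : Integrable (fun ω => ‖X ω‖ ^ 2) μ :=
    Integrable.of_bound (hX.norm.pow 2) (C ^ 2) (Filter.Eventually.of_forall fun ω => by
      rw [Real.norm_of_nonneg (sq_nonneg _)]
      exact pow_le_pow_left₀ (norm_nonneg _) (hC ω) 2)
  set m := ∫ ω', X ω' ∂μ with hm
  have hpt : ∀ ω, ‖X ω - m‖ ^ 2 = ‖X ω‖ ^ 2 - 2 * inner ℝ m (X ω) + ‖m‖ ^ 2 := fun ω => by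
    rw [norm_sub_sq_real, real_inner_comm]
  simp only [hpt]
  have hin : Integrable (fun ω => 2 * inner ℝ m (X ω)) μ := (hXi.const_inner m).const_mul 2
  have hfst : Integrable (fun ω => ‖X ω‖ ^ 2 - 2 * inner ℝ m (X ω)) μ := hXsq.sub hin
  rw [integral_add hfst (integrable_const _), integral_sub hXsq hin,
    integral_const_mul, integral_inner hXi, ← hm, real_inner_self_eq_norm_sq]
  simp only [integral_const, probReal_univ, smul_eq_mul]
  nlinarith [sq_nonneg ‖m‖]

/-! ### Regularity of the objective -/

lemma continuous_gradient_value (mdp : EpisodicMDP S A) {π : PolicyClass d S A ν} {M G : ℝ}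
    (hM : SmoothPolicy π M) (hG : BoundedScore π G) (hG0 : 0 ≤ G) (hM0 : 0 ≤ M) :
    Continuous (gradient (value mdp π)) := by
  refine (LipschitzWith.of_dist_le_mul (K := ⟨lipBound mdp M G, lipBound_nonneg mdp hM0⟩)
    fun x y => ?_).continuous
  rw [dist_eq_norm, dist_comm, dist_eq_norm]
  exact norm_gradient_value_sub_le mdp hM hG hG0 hM0 x y

lemma continuous_value (mdp : EpisodicMDP S A) {π : PolicyClass d S A ν} {M G : ℝ}
    (hM : SmoothPolicy π M) (hG : BoundedScore π G) (hG0 : 0 ≤ G) :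
    Continuous (value mdp π) :=
  continuous_iff_continuousAt.mpr fun θ => (hasGradientAt_value mdp hM hG hG0 θ θ).continuousAt

lemma abs_value_le (mdp : EpisodicMDP S A) (π : PolicyClass d S A ν)
    (θ : EuclideanSpace ℝ (Fin d)) : |value mdp π θ| ≤ mdp.rmax / (1 - mdp.discount) := by
  have h1 : 0 < 1 - mdp.discount := by linarith [mdp.discount_lt_one]
  have hb : ∀ τ, ‖discountedReturn mdp τ‖ ≤ mdp.rmax / (1 - mdp.discount) := by
    intro τ
    calc ‖discountedReturn mdp τ‖ ≤ ∑ h : Fin mdp.horizon, mdp.discount ^ (h : ℕ) * mdp.rmax :=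
          norm_sum_le_of_le _ fun h _ => abs_discounted_reward_le mdp τ h
      _ = (∑ h ∈ Finset.range mdp.horizon, mdp.discount ^ h) * mdp.rmax := by
          rw [Fin.sum_univ_eq_sum_range (fun h => mdp.discount ^ h * mdp.rmax), Finset.sum_mul]
      _ ≤ (1 / (1 - mdp.discount)) * mdp.rmax := by
          refine mul_le_mul_of_nonneg_right ?_ mdp.rmax_pos.le
          have h2 := geom_sum_mul_neg mdp.discount mdp.horizon
          rw [le_div_iff₀ h1, h2]
          linarith [pow_nonneg mdp.discount_pos.le mdp.horizon]
      _ = _ := by ring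
  rw [value_eq_integral]
  simpa using norm_integral_le_of_norm_le_const (μ := trajLaw mdp π θ)
    (Filter.Eventually.of_forall hb)

lemma value_le_optValue (mdp : EpisodicMDP S A) (π : PolicyClass d S A ν)
    (θ : EuclideanSpace ℝ (Fin d)) : value mdp π θ ≤ optValue mdp π :=
  le_ciSup (f := fun θ => value mdp π θ)
    ⟨mdp.rmax / (1 - mdp.discount), by
      rintro _ ⟨ϑ, rfl⟩
      exact (abs_le.mp (abs_value_le mdp π ϑ)).2⟩ θ

lemma optValue_sub_value_le (mdp : EpisodicMDP S A) (π : PolicyClass d S A ν)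
    (θ : EuclideanSpace ℝ (Fin d)) :
    optValue mdp π - value mdp π θ ≤ 2 * mdp.rmax / (1 - mdp.discount) := by
  have h1 : optValue mdp π ≤ mdp.rmax / (1 - mdp.discount) :=
    ciSup_le fun ϑ => (abs_le.mp (abs_value_le mdp π ϑ)).2
  have h2 := (abs_le.mp (abs_value_le mdp π θ)).1
  have h3 : 2 * mdp.rmax / (1 - mdp.discount) =
    mdp.rmax / (1 - mdp.discount) + mdp.rmax / (1 - mdp.discount) := by ring
  linarith

/-- A function whose gradient is `L`-Lipschitz is bounded below by its quadratic model. -/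
lemma le_of_lipschitz_gradient {E : Type*} [NormedAddCommGroup E] [InnerProductSpace ℝ E]
    [CompleteSpace E] {f : E → ℝ} {L : ℝ} (hf : ∀ x, HasGradientAt f (gradient f x) x)
    (hL : ∀ x y, ‖gradient f x - gradient f y‖ ≤ L * ‖y - x‖) (x v : E) :
    f x + inner ℝ (gradient f x) v - L / 2 * ‖v‖ ^ 2 ≤ f (x + v) := by
  -- The added quadratic compensates the worst decrease −Lt‖v‖² of the directional derivative, so φ
  -- is monotone on [0, 1].
  let φ : ℝ → ℝ := fun t => f (x + t • v) - t * inner ℝ (gradient f x) v + L / 2 * t ^ 2 * ‖v‖ ^ 2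
  have hφ : ∀ t, HasDerivAt φ (inner ℝ (gradient f (x + t • v)) v - inner ℝ (gradient f x) v +
      L * t * ‖v‖ ^ 2) t := by
    intro t
    have h1 : HasDerivAt (fun t : ℝ => x + t • v) v t := by
      simpa using ((hasDerivAt_id t).smul_const v).const_add x
    have h2 : HasDerivAt (fun t : ℝ => f (x + t • v)) (inner ℝ (gradient f (x + t • v)) v) t := by
      have := (hf (x + t • v)).hasFDerivAt.comp_hasDerivAt t h1
      rw [InnerProductSpace.toDual_apply_apply] at this
      exact this
    have h3 : HasDerivAt (fun t : ℝ => t * inner ℝ (gradient f x) v)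
        (inner ℝ (gradient f x) v) t := by
      simpa using (hasDerivAt_id t).mul_const (inner ℝ (gradient f x) v : ℝ)
    have h4 : HasDerivAt (fun t : ℝ => L / 2 * t ^ 2 * ‖v‖ ^ 2) (L * t * ‖v‖ ^ 2) t := by
      refine (((hasDerivAt_pow 2 t).const_mul (L / 2)).mul_const (‖v‖ ^ 2)).congr_deriv ?_
      push_cast
      ring
    exact (h2.sub h3).add h4
  have hmono : MonotoneOn φ (Set.Icc 0 1) := by
    refine monotoneOn_of_deriv_nonneg (convex_Icc 0 1)
      (fun t _ => (hφ t).continuousAt.continuousWithinAt)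
      (fun t _ => (hφ t).differentiableAt.differentiableWithinAt) fun t ht => ?_
    rw [interior_Icc] at ht
    rw [(hφ t).deriv, ← inner_sub_left]
    have h1 := hL (x + t • v) x
    have h2 : ‖x - (x + t • v)‖ = t * ‖v‖ := by
      rw [sub_add_cancel_left, norm_neg, norm_smul, Real.norm_of_nonneg ht.1.le]
    rw [h2] at h1
    have h3 := (abs_le.mp (abs_real_inner_le_norm (gradient f (x + t • v) - gradient f x) v)).1
    have h4 := mul_le_mul_of_nonneg_right h1 (norm_nonneg v)
    nlinarith
  have h01 := hmono (Set.left_mem_Icc.mpr zero_le_one) (Set.right_mem_Icc.mpr zero_le_one)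
    zero_le_one
  simp only [φ, zero_smul, one_smul, add_zero] at h01
  linarith

/-! ### The transition kernel of the algorithm -/

instance (mdp : EpisodicMDP S A) (π : PolicyClass d S A ν) (n : ℕ)
    (θ : EuclideanSpace ℝ (Fin d)) : IsProbabilityMeasure (batchLaw mdp π n θ) := by
  unfold batchLaw
  infer_instance

lemma measurable_batchLaw (mdp : EpisodicMDP S A) (π : PolicyClass d S A ν) (n : ℕ) :
    Measurable (batchLaw mdp π n) := by
  refine Measurable.measure_of_isPiSystem_of_isProbabilityMeasure generateFrom_pi.symm
    isPiSystem_pi ?_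
  rintro _ ⟨s, hs, rfl⟩
  simp only [batchLaw, Measure.pi_pi]
  exact Finset.measurable_prod _ fun i _ => Kernel.measurable_coe _ (hs i (Set.mem_univ i))

/-- The law of a batch of independent trajectories, as a kernel in the parameter. -/
noncomputable def batchKernel (mdp : EpisodicMDP S A) (π : PolicyClass d S A ν) (n : ℕ) :
    Kernel (EuclideanSpace ℝ (Fin d)) (Fin n → Fin mdp.horizon → S × A) :=
  ⟨batchLaw mdp π n, measurable_batchLaw mdp π n⟩

instance (mdp : EpisodicMDP S A) (π : PolicyClass d S A ν) (n : ℕ) :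
    IsMarkovKernel (batchKernel mdp π n) :=
  ⟨fun θ => inferInstanceAs (IsProbabilityMeasure (batchLaw mdp π n θ))⟩

lemma measurable_map_kernel {X Y Z : Type*} [MeasurableSpace X] [MeasurableSpace Y]
    [MeasurableSpace Z] (κ : Kernel X Y) [IsSFiniteKernel κ] {f : X → Y → Z}
    (hf : Measurable (fun q : X × Y => f q.1 q.2)) : Measurable (fun x => (κ x).map (f x)) := by
  refine Measure.measurable_of_measurable_coe _ fun s hs => ?_
  have h1 : ∀ x, (κ x).map (f x) s = κ x (Prod.mk x ⁻¹' ((fun q : X × Y => f q.1 q.2) ⁻¹' s)) :=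
    fun x => Measure.map_apply (hf.comp measurable_prodMk_left) hs
  simp only [h1]
  exact Kernel.measurable_kernel_prodMk_left (hf hs)

lemma measurable_average_gpomdp (mdp : EpisodicMDP S A) {π : PolicyClass d S A ν} {M : ℝ}
    (hM : SmoothPolicy π M) (n : ℕ) {X : Type*} [MeasurableSpace X]
    {f : X → Fin n → Fin mdp.horizon → S × A} {g : X → EuclideanSpace ℝ (Fin d)}
    (hf : Measurable f) (hg : Measurable g) :
    Measurable (fun x => (1 / (n : ℝ)) • ∑ i, gpomdp mdp π (f x i) (g x)) := by
  have h : Measurable (fun x => ∑ i, gpomdp mdp π (f x i) (g x)) :=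
    Finset.measurable_sum _ fun i _ =>
      hM.measurable_gpomdp_comp mdp (measurable_pi_iff.mp hf i) hg
  exact h.const_smul (1 / (n : ℝ))

lemma measurable_average_gpomdpOff (mdp : EpisodicMDP S A) {π : PolicyClass d S A ν} {M : ℝ}
    (hM : SmoothPolicy π M) (n : ℕ) {X : Type*} [MeasurableSpace X]
    {f : X → Fin n → Fin mdp.horizon → S × A} {g₁ g₂ : X → EuclideanSpace ℝ (Fin d)}
    (hf : Measurable f) (hg₁ : Measurable g₁) (hg₂ : Measurable g₂) :
    Measurable (fun x => (1 / (n : ℝ)) • ∑ i, gpomdpOff mdp π (f x i) (g₁ x) (g₂ x)) := by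
  have h : Measurable (fun x => ∑ i, gpomdpOff mdp π (f x i) (g₁ x) (g₂ x)) :=
    Finset.measurable_sum _ fun i _ =>
      hM.measurable_gpomdpOff_comp mdp (measurable_pi_iff.mp hf i) hg₁ hg₂
  exact h.const_smul (1 / (n : ℝ))

/-- `iterLaw` is built with `bind`, which is a genuine mixture only for measurable families of
measures; total mass one and the tower property both rest on this. -/
lemma measurable_stepLaw (mdp : EpisodicMDP S A) {π : PolicyClass d S A ν} {M : ℝ}
    (hM : SmoothPolicy π M) (N B : ℕ) (η p : ℝ) : Measurable (stepLaw mdp π N B η p) := by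
  have hθ : Measurable (fun x : EuclideanSpace ℝ (Fin d) × EuclideanSpace ℝ (Fin d) =>
      x.1 + η • x.2) := by fun_prop
  have h1 : Measurable (fun x : EuclideanSpace ℝ (Fin d) × EuclideanSpace ℝ (Fin d) =>
      largeBatch mdp π N (x.1 + η • x.2)) :=
    measurable_map_kernel ((batchKernel mdp π N).comap _ hθ)
      (f := fun x τ => (x.1 + η • x.2,
        (1 / (N : ℝ)) • ∑ i, gpomdp mdp π (τ i) (x.1 + η • x.2)))
      (Measurable.prodMk (by fun_prop)
        (measurable_average_gpomdp mdp hM N measurable_snd (by fun_prop)))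
  have h2 : Measurable (fun x : EuclideanSpace ℝ (Fin d) × EuclideanSpace ℝ (Fin d) =>
      smallBatch mdp π B x.1 x.2 (x.1 + η • x.2)) :=
    measurable_map_kernel ((batchKernel mdp π B).comap _ hθ)
      (f := fun x τ => (x.1 + η • x.2,
        (1 / (B : ℝ)) • ∑ i, gpomdp mdp π (τ i) (x.1 + η • x.2) + x.2 -
          (1 / (B : ℝ)) • ∑ i, gpomdpOff mdp π (τ i) (x.1 + η • x.2) x.1))
      (Measurable.prodMk (by fun_prop)
        (((measurable_average_gpomdp mdp hM B measurable_snd (by fun_prop)).add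
          (by fun_prop)).sub
            (measurable_average_gpomdpOff mdp hM B measurable_snd (by fun_prop) (by fun_prop))))
  refine Measure.measurable_of_measurable_coe _ fun s hs => ?_
  simp only [stepLaw, Measure.add_apply, Measure.smul_apply, smul_eq_mul]
  exact ((Measure.measurable_coe hs).comp h1 |>.const_mul _).add
    ((Measure.measurable_coe hs).comp h2 |>.const_mul _)

lemma measurable_largeBatch_map (mdp : EpisodicMDP S A) {π : PolicyClass d S A ν} {M : ℝ}
    (hM : SmoothPolicy π M) (N : ℕ) (θ : EuclideanSpace ℝ (Fin d)) :
    Measurable (fun τ : Fin N → Fin mdp.horizon → S × A =>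
      (θ, (1 / (N : ℝ)) • ∑ i, gpomdp mdp π (τ i) θ)) :=
  measurable_const.prodMk (measurable_average_gpomdp mdp hM N measurable_id measurable_const)

lemma measurable_smallBatch_map (mdp : EpisodicMDP S A) {π : PolicyClass d S A ν} {M : ℝ}
    (hM : SmoothPolicy π M) (B : ℕ) (θprev vprev θ : EuclideanSpace ℝ (Fin d)) :
    Measurable (fun τ : Fin B → Fin mdp.horizon → S × A =>
      (θ, (1 / (B : ℝ)) • ∑ i, gpomdp mdp π (τ i) θ + vprev -
        (1 / (B : ℝ)) • ∑ i, gpomdpOff mdp π (τ i) θ θprev)) :=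
  measurable_const.prodMk (((measurable_average_gpomdp mdp hM B measurable_id
    measurable_const).add_const _).sub
      (measurable_average_gpomdpOff mdp hM B measurable_id measurable_const measurable_const))

lemma isProbabilityMeasure_largeBatch (mdp : EpisodicMDP S A) {π : PolicyClass d S A ν} {M : ℝ}
    (hM : SmoothPolicy π M) (N : ℕ) (θ : EuclideanSpace ℝ (Fin d)) :
    IsProbabilityMeasure (largeBatch mdp π N θ) :=
  Measure.isProbabilityMeasure_map (measurable_largeBatch_map mdp hM N θ).aemeasurable

lemma isProbabilityMeasure_smallBatch (mdp : EpisodicMDP S A) {π : PolicyClass d S A ν} {M : ℝ}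
    (hM : SmoothPolicy π M) (B : ℕ) (θprev vprev θ : EuclideanSpace ℝ (Fin d)) :
    IsProbabilityMeasure (smallBatch mdp π B θprev vprev θ) :=
  Measure.isProbabilityMeasure_map (measurable_smallBatch_map mdp hM B θprev vprev θ).aemeasurable

lemma isProbabilityMeasure_stepLaw (mdp : EpisodicMDP S A) {π : PolicyClass d S A ν} {M : ℝ}
    (hM : SmoothPolicy π M) (N B : ℕ) (η : ℝ) {p : ℝ} (hp0 : 0 ≤ p) (hp1 : p ≤ 1)
    (x : EuclideanSpace ℝ (Fin d) × EuclideanSpace ℝ (Fin d)) :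
    IsProbabilityMeasure (stepLaw mdp π N B η p x) := by
  have := isProbabilityMeasure_largeBatch mdp hM N (x.1 + η • x.2)
  have := isProbabilityMeasure_smallBatch mdp hM B x.1 x.2 (x.1 + η • x.2)
  refine ⟨?_⟩
  simp only [stepLaw, Measure.add_apply, Measure.smul_apply, smul_eq_mul, measure_univ, mul_one]
  rw [← ENNReal.ofReal_add hp0 (by linarith)]
  simp

/-- One iteration of the algorithm as a kernel. -/
noncomputable def stepKernel (mdp : EpisodicMDP S A) {π : PolicyClass d S A ν} {M : ℝ}
    (hM : SmoothPolicy π M) (N B : ℕ) (η p : ℝ) :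
    Kernel (EuclideanSpace ℝ (Fin d) × EuclideanSpace ℝ (Fin d))
      (EuclideanSpace ℝ (Fin d) × EuclideanSpace ℝ (Fin d)) :=
  ⟨stepLaw mdp π N B η p, measurable_stepLaw mdp hM N B η p⟩

lemma isProbabilityMeasure_iterLaw (mdp : EpisodicMDP S A) {π : PolicyClass d S A ν} {M : ℝ}
    (hM : SmoothPolicy π M) (N B : ℕ) (η : ℝ) {p : ℝ} (hp0 : 0 ≤ p) (hp1 : p ≤ 1)
    (θ₀ : EuclideanSpace ℝ (Fin d)) (t : ℕ) :
    IsProbabilityMeasure (iterLaw mdp π N B η p θ₀ t) := by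
  induction t with
  | zero => exact isProbabilityMeasure_largeBatch mdp hM N θ₀
  | succ t ih =>
    rw [iterLaw]
    exact isProbabilityMeasure_bind (measurable_stepLaw mdp hM N B η p).aemeasurable
      (Filter.Eventually.of_forall (isProbabilityMeasure_stepLaw mdp hM N B η hp0 hp1))

lemma integral_iterLaw_succ (mdp : EpisodicMDP S A) {π : PolicyClass d S A ν} {M : ℝ}
    (hM : SmoothPolicy π M) (N B : ℕ) (η p : ℝ) (θ₀ : EuclideanSpace ℝ (Fin d)) (t : ℕ)
    {F : EuclideanSpace ℝ (Fin d) × EuclideanSpace ℝ (Fin d) → ℝ}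
    (hF : Integrable F (iterLaw mdp π N B η p θ₀ (t + 1))) :
    ∫ y, F y ∂iterLaw mdp π N B η p θ₀ (t + 1) =
      ∫ x, ∫ y, F y ∂stepLaw mdp π N B η p x ∂iterLaw mdp π N B η p θ₀ t := by
  have h1 : iterLaw mdp π N B η p θ₀ (t + 1) = (stepKernel mdp hM N B η p ∘ₖ
      Kernel.const Unit (iterLaw mdp π N B η p θ₀ t)) () := by
    rw [Kernel.comp_apply, Kernel.const_apply, iterLaw]
    rfl
  rw [h1] at hF ⊢
  rw [Kernel.integral_comp hF, Kernel.const_apply]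
  rfl

/-! ### The truncated potential -/

/-- The suboptimality gap plus a multiple of the squared estimation error, truncated at `K`. -/
noncomputable def potential (mdp : EpisodicMDP S A) (π : PolicyClass d S A ν) (β K : ℝ)
    (x : EuclideanSpace ℝ (Fin d) × EuclideanSpace ℝ (Fin d)) : ℝ :=
  min (optValue mdp π - value mdp π x.1 + β * ‖x.2 - gradient (value mdp π) x.1‖ ^ 2) K

lemma measurable_potential (mdp : EpisodicMDP S A) {π : PolicyClass d S A ν} {M G : ℝ}
    (hM : SmoothPolicy π M) (hG : BoundedScore π G) (hG0 : 0 ≤ G) (hM0 : 0 ≤ M) (β K : ℝ) :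
    Measurable (potential mdp π β K) := by
  have h1 := (continuous_value mdp hM hG hG0).measurable
  have h2 := (continuous_gradient_value mdp hM hG hG0 hM0).measurable
  unfold potential
  fun_prop

lemma potential_nonneg (mdp : EpisodicMDP S A) (π : PolicyClass d S A ν) {β K : ℝ} (hβ : 0 ≤ β)
    (hK : 0 ≤ K) (x : EuclideanSpace ℝ (Fin d) × EuclideanSpace ℝ (Fin d)) :
    0 ≤ potential mdp π β K x :=
  le_min (add_nonneg (sub_nonneg.mpr (value_le_optValue mdp π x.1))
    (mul_nonneg hβ (sq_nonneg _))) hK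

lemma norm_potential_le (mdp : EpisodicMDP S A) (π : PolicyClass d S A ν) {β K : ℝ} (hβ : 0 ≤ β)
    (hK : 0 ≤ K) (x : EuclideanSpace ℝ (Fin d) × EuclideanSpace ℝ (Fin d)) :
    ‖potential mdp π β K x‖ ≤ K := by
  rw [Real.norm_of_nonneg (potential_nonneg mdp π hβ hK x)]
  exact min_le_right _ _

/-- Truncation also makes integrability automatic, so no moments of v_t have to be tracked. -/
lemma integrable_potential (mdp : EpisodicMDP S A) {π : PolicyClass d S A ν} {M G : ℝ}
    (hM : SmoothPolicy π M) (hG : BoundedScore π G) (hG0 : 0 ≤ G) (hM0 : 0 ≤ M) {β K : ℝ}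
    (hβ : 0 ≤ β) (hK : 0 ≤ K)
    (μ : Measure (EuclideanSpace ℝ (Fin d) × EuclideanSpace ℝ (Fin d))) [IsFiniteMeasure μ] :
    Integrable (potential mdp π β K) μ :=
  Integrable.of_bound (measurable_potential mdp hM hG hG0 hM0 β K).aestronglyMeasurable K
    (Filter.Eventually.of_forall (norm_potential_le mdp π hβ hK))

/-- Jensen's inequality for the potential at a random direction with a fixed parameter. -/
lemma integral_potential_map_le {Ω : Type*} [MeasurableSpace Ω] (P : Measure Ω)
    [IsProbabilityMeasure P] (mdp : EpisodicMDP S A) {π : PolicyClass d S A ν} {M G : ℝ}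
    (hM : SmoothPolicy π M) (hG : BoundedScore π G) (hG0 : 0 ≤ G) (hM0 : 0 ≤ M) {β K : ℝ}
    (hβ : 0 ≤ β) (hK : 0 ≤ K) (θ : EuclideanSpace ℝ (Fin d)) {v : Ω → EuclideanSpace ℝ (Fin d)}
    (hv : Measurable v) {C : ℝ} (hC : ∀ ω, ‖v ω‖ ≤ C) :
    ∫ y, potential mdp π β K y ∂(P.map fun ω => (θ, v ω)) ≤
      min (optValue mdp π - value mdp π θ +
        β * ∫ ω, ‖v ω - gradient (value mdp π) θ‖ ^ 2 ∂P) K := by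
  have hpm := measurable_potential mdp hM hG hG0 hM0 β K
  have hm : Measurable (fun ω => (θ, v ω)) := measurable_const.prodMk hv
  have hpi : Integrable (fun ω => potential mdp π β K (θ, v ω)) P :=
    Integrable.of_bound (hpm.comp hm).aestronglyMeasurable K
      (Filter.Eventually.of_forall fun ω => norm_potential_le mdp π hβ hK _)
  have hsq : Integrable (fun ω => ‖v ω - gradient (value mdp π) θ‖ ^ 2) P :=
    Integrable.of_bound ((hv.sub_const _).norm.pow_const 2).aestronglyMeasurable
      ((C + ‖gradient (value mdp π) θ‖) ^ 2) (Filter.Eventually.of_forall fun ω => by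
        rw [Real.norm_of_nonneg (sq_nonneg _)]
        exact pow_le_pow_left₀ (norm_nonneg _)
          ((norm_sub_le _ _).trans (add_le_add (hC ω) le_rfl)) 2)
  rw [integral_map hm.aemeasurable hpm.aestronglyMeasurable]
  refine le_min ?_ ?_
  · calc _ ≤ ∫ ω, (optValue mdp π - value mdp π θ +
          β * ‖v ω - gradient (value mdp π) θ‖ ^ 2) ∂P :=
        integral_mono hpi ((integrable_const _).add (hsq.const_mul β)) fun ω => min_le_left _ _
      _ = _ := by
        rw [integral_add (integrable_const _) (hsq.const_mul β), integral_const_mul]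
        simp
  · calc _ ≤ ∫ _, K ∂P := integral_mono hpi (integrable_const _) fun ω => min_le_right _ _
      _ = K := by simp

lemma norm_average_le {E : Type*} [NormedAddCommGroup E] [NormedSpace ℝ E] {n : ℕ} (hn : 0 < n)
    {f : Fin n → E} {C : ℝ} (hC : ∀ i, ‖f i‖ ≤ C) : ‖(1 / (n : ℝ)) • ∑ i, f i‖ ≤ C := by
  have hn' : (0 : ℝ) < n := by positivity
  rw [norm_smul, Real.norm_of_nonneg (by positivity)]
  have h1 : ‖∑ i, f i‖ ≤ n * C := by
    refine (norm_sum_le_of_le _ fun i _ => hC i).trans (le_of_eq ?_)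
    simp
  calc _ ≤ 1 / (n : ℝ) * (n * C) := mul_le_mul_of_nonneg_left h1 (by positivity)
    _ = C := by field_simp

lemma integral_potential_largeBatch_le (mdp : EpisodicMDP S A) {π : PolicyClass d S A ν}
    {M G σ : ℝ} (hM : SmoothPolicy π M) (hG : BoundedScore π G) (hG0 : 0 ≤ G) (hM0 : 0 ≤ M)
    (hvar : FiniteVariance mdp π σ) {β K : ℝ} (hβ : 0 ≤ β) (hK : 0 ≤ K) {N : ℕ} (hN : 0 < N)
    (θ : EuclideanSpace ℝ (Fin d)) :
    ∫ y, potential mdp π β K y ∂largeBatch mdp π N θ ≤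
      optValue mdp π - value mdp π θ + β * (σ ^ 2 / N) := by
  have hgm : Measurable (fun τ => gpomdp mdp π τ θ) :=
    hM.measurable_gpomdp_comp mdp measurable_id measurable_const
  have h1 := integral_potential_map_le (batchLaw mdp π N θ) mdp hM hG hG0 hM0 hβ hK θ
    (measurable_average_gpomdp mdp hM N measurable_id measurable_const)
    (fun τ => norm_average_le hN fun i => norm_gpomdp_le mdp hM hG hG0 (τ i) θ)
  refine (h1.trans (min_le_left _ _)).trans ?_
  have h2 := integral_norm_add_average_sub_sq (trajLaw mdp π θ) hgm
    (fun τ => norm_gpomdp_le mdp hM hG hG0 τ θ) hN 0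
  rw [← gradient_value_eq_integral_gpomdp mdp hM hG hG0 θ] at h2
  simp only [zero_add, norm_zero] at h2
  refine add_le_add le_rfl (mul_le_mul_of_nonneg_left ?_ hβ)
  refine (le_of_eq h2).trans ?_
  have h3 := hvar θ
  rw [← gradient_value_eq_integral_gpomdp mdp hM hG hG0 θ] at h3
  have h4 : (0 : ℝ) ≤ 1 / N := by positivity
  have := mul_le_mul_of_nonneg_left h3 h4
  rw [div_eq_mul_one_div (σ ^ 2), mul_comm (σ ^ 2)]
  simpa using this

/-- For trajectories drawn at θ, the two estimators have means ∇V(θ) and ∇V(θprev), so the new error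
is the old one plus a centred average. The minimum with K is kept for the states above the
truncation level. -/
lemma integral_potential_smallBatch_le (mdp : EpisodicMDP S A) {π : PolicyClass d S A ν}
    {M G : ℝ} (hM : SmoothPolicy π M) (hG : BoundedScore π G) (hG0 : 0 ≤ G) (hM0 : 0 ≤ M)
    {β K : ℝ} (hβ : 0 ≤ β) (hK : 0 ≤ K) {B : ℕ} (hB : 0 < B)
    (θprev vprev θ : EuclideanSpace ℝ (Fin d)) :
    ∫ y, potential mdp π β K y ∂smallBatch mdp π B θprev vprev θ ≤
      min (optValue mdp π - value mdp π θ + β * (‖vprev - gradient (value mdp π) θprev‖ ^ 2 +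
        1 / (B : ℝ) * ∫ τ, ‖gpomdpOff mdp π τ θ θ - gpomdpOff mdp π τ θ θprev‖ ^ 2
          ∂trajLaw mdp π θ)) K := by
  set X : (Fin mdp.horizon → S × A) → EuclideanSpace ℝ (Fin d) := fun τ =>
    gpomdpOff mdp π τ θ θ - gpomdpOff mdp π τ θ θprev with hX
  have hXm : Measurable X :=
    (hM.measurable_gpomdpOff_comp mdp measurable_id measurable_const measurable_const).sub
      (hM.measurable_gpomdpOff_comp mdp measurable_id measurable_const measurable_const)
  obtain ⟨C, hC⟩ : ∃ C, ∀ τ, ‖X τ‖ ≤ C := ⟨_, fun τ => (norm_sub_le _ _).trans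
    (add_le_add (norm_gpomdpOff_le mdp hM hG hG0 τ θ θ)
      (norm_gpomdpOff_le mdp hM hG hG0 τ θ θprev))⟩
  have hmean : ∫ τ, X τ ∂trajLaw mdp π θ =
      gradient (value mdp π) θ - gradient (value mdp π) θprev := by
    rw [hX, integral_sub (integrable_gpomdpOff mdp hM hG hG0 θ θ)
      (integrable_gpomdpOff mdp hM hG hG0 θ θprev), ← gradient_value mdp hM hG hG0 θ θ,
      ← gradient_value mdp hM hG hG0 θ θprev]
  have hform : ∀ τ : Fin B → Fin mdp.horizon → S × A,
      (1 / (B : ℝ)) • ∑ i, gpomdp mdp π (τ i) θ + vprev -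
        (1 / (B : ℝ)) • ∑ i, gpomdpOff mdp π (τ i) θ θprev =
      (1 / (B : ℝ)) • ∑ i, X (τ i) + vprev := by
    intro τ
    simp only [hX, Finset.sum_sub_distrib, smul_sub, gpomdpOff_self]
    abel
  have hvm : Measurable (fun τ : Fin B → Fin mdp.horizon → S × A =>
      (1 / (B : ℝ)) • ∑ i, X (τ i) + vprev) := by
    have h : Measurable (fun τ : Fin B → Fin mdp.horizon → S × A => ∑ i, X (τ i)) := by fun_prop
    exact (h.const_smul (1 / (B : ℝ))).add_const _
  have h1 := integral_potential_map_le (batchLaw mdp π B θ) mdp hM hG hG0 hM0 hβ hK θ hvm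
    (fun τ => (norm_add_le _ _).trans (add_le_add (norm_average_le hB fun i => hC (τ i)) le_rfl))
  have hs : smallBatch mdp π B θprev vprev θ = (batchLaw mdp π B θ).map
      (fun τ => (θ, (1 / (B : ℝ)) • ∑ i, X (τ i) + vprev)) := by
    rw [smallBatch]
    simp only [hform]
  rw [hs]
  refine h1.trans (min_le_min (add_le_add le_rfl (mul_le_mul_of_nonneg_left ?_ hβ)) le_rfl)
  have h2 := integral_norm_add_average_sub_sq (trajLaw mdp π θ) hXm hC hB
    (vprev - gradient (value mdp π) θprev)
  have h3 := integral_norm_sub_integral_sq_le (trajLaw mdp π θ) hXm.aestronglyMeasurable hC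
  rw [hmean] at h2 h3
  have h4 : ∀ τ : Fin B → Fin mdp.horizon → S × A,
      (1 / (B : ℝ)) • ∑ i, X (τ i) + vprev - gradient (value mdp π) θ =
      vprev - gradient (value mdp π) θprev + ((1 / (B : ℝ)) • ∑ i, X (τ i) -
        (gradient (value mdp π) θ - gradient (value mdp π) θprev)) := by
    intro τ
    abel
  simp only [h4]
  refine (le_of_eq h2).trans (add_le_add le_rfl (mul_le_mul_of_nonneg_left h3 (by positivity)))

lemma integral_potential_stepLaw (mdp : EpisodicMDP S A) {π : PolicyClass d S A ν}
    {M G : ℝ} (hM : SmoothPolicy π M) (hG : BoundedScore π G) (hG0 : 0 ≤ G) (hM0 : 0 ≤ M)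
    {β K : ℝ} (hβ : 0 ≤ β) (hK : 0 ≤ K) (N B : ℕ) (η : ℝ) {p : ℝ} (hp0 : 0 ≤ p) (hp1 : p ≤ 1)
    (x : EuclideanSpace ℝ (Fin d) × EuclideanSpace ℝ (Fin d)) :
    ∫ y, potential mdp π β K y ∂stepLaw mdp π N B η p x =
      p * ∫ y, potential mdp π β K y ∂largeBatch mdp π N (x.1 + η • x.2) +
        (1 - p) * ∫ y, potential mdp π β K y ∂smallBatch mdp π B x.1 x.2 (x.1 + η • x.2) := by
  have := isProbabilityMeasure_largeBatch mdp hM N (x.1 + η • x.2)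
  have := isProbabilityMeasure_smallBatch mdp hM B x.1 x.2 (x.1 + η • x.2)
  rw [stepLaw, integral_add_measure
    ((integrable_potential mdp hM hG hG0 hM0 hβ hK _).smul_measure ENNReal.ofReal_ne_top)
    ((integrable_potential mdp hM hG hG0 hM0 hβ hK _).smul_measure ENNReal.ofReal_ne_top),
    integral_smul_measure, integral_smul_measure, ENNReal.toReal_ofReal hp0,
    ENNReal.toReal_ofReal (by linarith), smul_eq_mul, smul_eq_mul]

/-! ### Expected decrease of the potential -/

/-- The level at which the potential is truncated. -/
noncomputable def truncLevel (mdp : EpisodicMDP S A) (G η p : ℝ) : ℝ :=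
  2 * mdp.rmax / (1 - mdp.discount) +
    η / (2 * p) * (mdp.rmax * G / (1 - mdp.discount) ^ 2) ^ 2

/-- The second hypothesis says that the error part of the potential is below K. Solved for e², its
two terms contribute p·a² and a²/16 once `hstep` is inserted. -/
lemma scaled_error_sq_le {R G a η p e : ℝ} (hR : 0 < R) (ha : 0 < a) (hη : 0 < η)
    (hp : 0 < p) (hstep : η * (R * G ^ 2) ≤ a ^ 3 / 4)
    (he : η / (2 * p) * e ^ 2 ≤ 2 * R / a + η / (2 * p) * (R * G / a ^ 2) ^ 2) :
    (η * G * e) ^ 2 ≤ a ^ 2 * (p + 1 / 16) := by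
  have h1 : e ^ 2 ≤ 4 * p * R / (a * η) + (R * G / a ^ 2) ^ 2 := by
    have h2 := mul_le_mul_of_nonneg_left he (show 0 ≤ 2 * p / η by positivity)
    refine le_trans (le_of_eq ?_) (h2.trans (le_of_eq ?_))
    · field_simp
    · field_simp
      ring
  have h3 : (η * G) ^ 2 * (4 * p * R / (a * η)) ≤ p * a ^ 2 := by
    have : (η * G) ^ 2 * (4 * p * R / (a * η)) = 4 * p / a * (η * (R * G ^ 2)) := by
      field_simp
    rw [this]
    calc _ ≤ 4 * p / a * (a ^ 3 / 4) := by gcongr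
      _ = p * a ^ 2 := by field_simp
  have h4 : (η * G) ^ 2 * (R * G / a ^ 2) ^ 2 ≤ a ^ 2 / 16 := by
    have : (η * G) ^ 2 * (R * G / a ^ 2) ^ 2 = (η * (R * G ^ 2)) ^ 2 / a ^ 4 := by
      field_simp
    rw [this, div_le_iff₀ (by positivity)]
    calc _ ≤ (a ^ 3 / 4) ^ 2 := pow_le_pow_left₀ (by positivity) hstep 2
      _ = _ := by ring
  calc (η * G * e) ^ 2 = (η * G) ^ 2 * e ^ 2 := by ring
    _ ≤ (η * G) ^ 2 * (4 * p * R / (a * η) + (R * G / a ^ 2) ^ 2) := by gcongr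
    _ ≤ _ := by linarith

/-- Here f and f' are the old and new gaps, e the error, w = ‖v‖, n = ‖∇V‖ and I their inner
product. The term −ηI releases −(η/2)w²: one half pays for curvature through `hηL`, the other for
small-batch noise through `hC`. The resulting (η/2)e² is p·(η/2p)e², exactly what the large batch
erases. -/
lemma potential_step_arith {f f' n e w η p s J B C L K I : ℝ} (hη : 0 < η) (hp : 0 < p)
    (hp1 : p ≤ 1) (hB : 0 < B) (hf' : f' ≤ f - η * I + L / 2 * (η * w) ^ 2)
    (hI : e ^ 2 = w ^ 2 - 2 * I + n ^ 2)
    (hJ : J ≤ (η * w) ^ 2 * C) (hηL : η * L ≤ 1 / 2) (hC : (1 - p) * (η ^ 2 * C) ≤ p * B / 2) :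
    p * (f' + η / (2 * p) * s) + (1 - p) *
      (min (f' + η / (2 * p) * (e ^ 2 + 1 / B * J)) K) ≤
        f + η / (2 * p) * e ^ 2 - η / 2 * n ^ 2 + η * s / 2 := by
  have hq : 0 ≤ 1 - p := by linarith
  have h1 := mul_le_mul_of_nonneg_left
    (min_le_left (f' + η / (2 * p) * (e ^ 2 + 1 / B * J)) K) hq
  have h2 : (1 - p) * (η / (2 * p) * (1 / B * J)) ≤ η / 4 * w ^ 2 := by
    calc (1 - p) * (η / (2 * p) * (1 / B * J)) ≤
          (1 - p) * (η / (2 * p) * (1 / B * ((η * w) ^ 2 * C))) := by gcongr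
      _ = ((1 - p) * (η ^ 2 * C)) * (η / (2 * p * B) * w ^ 2) := by
          field_simp
      _ ≤ (p * B / 2) * (η / (2 * p * B) * w ^ 2) := by gcongr
      _ = _ := by
          field_simp
          ring
  have h3 : p * (η / (2 * p) * s) = η * s / 2 := by field_simp
  have h4 : η / 2 * e ^ 2 = p * (η / (2 * p) * e ^ 2) := by field_simp
  have h5 : L / 2 * (η * w) ^ 2 ≤ η / 4 * w ^ 2 := by
    have : L / 2 * (η * w) ^ 2 = (η * L) * (η / 2 * w ^ 2) := by ring
    rw [this]
    calc _ ≤ 1 / 2 * (η / 2 * w ^ 2) := by gcongr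
      _ = _ := by ring
  have h6 : η * I = η / 2 * (w ^ 2 + n ^ 2 - e ^ 2) := by
    rw [hI]
    ring
  nlinarith

/-- The drift inequality holds at every state x, with no restriction on the length of the step. -/
theorem integral_potential_stepLaw_le (mdp : EpisodicMDP S A) {π : PolicyClass d S A ν}
    {M G σ W η p : ℝ} (hM : SmoothPolicy π M) (hG : BoundedScore π G) (hG0 : 0 < G) (hM0 : 0 < M)
    (hW : 0 < W) (hvar : FiniteVariance mdp π σ) {N B : ℕ} (hN : 0 < N) (hB : 0 < B)
    (hη : 0 < η) (hp0 : 0 < p) (hp1 : p ≤ 1)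
    (hη_noise : p < 1 → η ^ 2 ≤
      p / (1 - p) * ((B : ℝ) / (2 * constC mdp.rmax mdp.discount G M W)))
    (hη_smooth : η ^ 2 ≤ 1 / (4 * constL mdp.rmax mdp.discount G M ^ 2))
    (x : EuclideanSpace ℝ (Fin d) × EuclideanSpace ℝ (Fin d)) :
    ∫ y, potential mdp π (η / (2 * p)) (truncLevel mdp G η p) y ∂stepLaw mdp π N B η p x ≤
      potential mdp π (η / (2 * p)) (truncLevel mdp G η p) x -
        η / 2 * ‖gradient (value mdp π) x.1‖ ^ 2 + η * (σ ^ 2 / N) / 2 := by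
  have hR := mdp.rmax_pos
  have ha0 : 0 < 1 - mdp.discount := by linarith [mdp.discount_lt_one]
  set a := 1 - mdp.discount with had
  set L := constL mdp.rmax mdp.discount G M with hLd
  have hLeq : L = mdp.rmax * (M / a ^ 2 + 2 * (G ^ 2 / a ^ 3)) := constL_eq _ _ _ _
  have hL0 : 0 < L := by rw [hLeq]; positivity
  have hηL : η * L ≤ 1 / 2 := by
    rw [le_div_iff₀ (by positivity)] at hη_smooth
    nlinarith [mul_pos hη hL0]
  have hstep : η * (mdp.rmax * G ^ 2) ≤ a ^ 3 / 4 := by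
    have h1 : 2 * (mdp.rmax * G ^ 2) / a ^ 3 ≤ L := by
      rw [hLeq]
      have : 0 ≤ mdp.rmax * (M / a ^ 2) := by positivity
      have h2 : 2 * (mdp.rmax * G ^ 2) / a ^ 3 = mdp.rmax * (2 * (G ^ 2 / a ^ 3)) := by ring
      rw [h2]
      linarith
    rw [div_le_iff₀ (by positivity)] at h1
    nlinarith [mul_le_mul_of_nonneg_left h1 hη.le,
      mul_le_mul_of_nonneg_right hηL (show 0 ≤ a ^ 3 by positivity)]
  set β := η / (2 * p) with hβd
  have hβ : 0 ≤ β := by positivity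
  set K := truncLevel mdp G η p with hKd
  have hKeq : K = 2 * mdp.rmax / a + β * (mdp.rmax * G / a ^ 2) ^ 2 := rfl
  have hK : 0 ≤ K := by rw [hKeq]; positivity
  have hgrad : ‖gradient (value mdp π) x.1‖ ≤ mdp.rmax * G / a ^ 2 :=
    (norm_gradient_value_le mdp hM hG hG0.le x.1).trans (gradBound_le mdp hG0.le)
  set θ' := x.1 + η • x.2 with hθ'
  have hlarge := integral_potential_largeBatch_le mdp hM hG hG0.le hM0.le hvar hβ hK hN θ'
  have hsmall := integral_potential_smallBatch_le mdp hM hG hG0.le hM0.le hβ hK hB x.1 x.2 θ'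
  rw [integral_potential_stepLaw mdp hM hG hG0.le hM0.le hβ hK N B η hp0.le hp1 x]
  refine (add_le_add (mul_le_mul_of_nonneg_left hlarge hp0.le)
    (mul_le_mul_of_nonneg_left hsmall (by linarith))).trans ?_
  rcases le_total (optValue mdp π - value mdp π x.1 +
    β * ‖x.2 - gradient (value mdp π) x.1‖ ^ 2) K with hcase | hcase
  · rw [show potential mdp π β K x = _ from min_eq_left hcase]
    have hdiff : x.1 - θ' = -(η • x.2) := by rw [hθ']; abel
    have hnd : ‖x.1 - θ'‖ = η * ‖x.2‖ := by
      rw [hdiff, norm_neg, norm_smul, Real.norm_of_nonneg hη.le]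
    have herr : (η * G * ‖x.2 - gradient (value mdp π) x.1‖) ^ 2 ≤ a ^ 2 * (p + 1 / 16) := by
      refine scaled_error_sq_le hR ha0 hη hp0 hstep ?_
      rw [← hβd, ← hKeq]
      linarith [value_le_optValue mdp π x.1]
    have hgr : η * G * ‖gradient (value mdp π) x.1‖ ≤ a / 4 := by
      calc _ ≤ η * G * (mdp.rmax * G / a ^ 2) := by gcongr
        _ = η * (mdp.rmax * G ^ 2) / a ^ 2 := by ring
        _ ≤ a ^ 3 / 4 / a ^ 2 := by gcongr
        _ = a / 4 := by field_simp
    -- The step is η times error plus gradient: c·a bounds the first after scaling by G, and a/4 the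
    -- second.
    have hdist : ∀ c : ℝ, 0 ≤ c → p + 1 / 16 ≤ c ^ 2 → G * ‖x.1 - θ'‖ ≤ (c + 1 / 4) * a := by
      intro c hc hpc
      have h1 : η * G * ‖x.2 - gradient (value mdp π) x.1‖ ≤ c * a := by
        refine le_of_sq_le_sq ?_ (by positivity)
        refine herr.trans ?_
        rw [mul_pow, mul_comm]
        gcongr
      have h2 : ‖x.2‖ ≤ ‖x.2 - gradient (value mdp π) x.1‖ + ‖gradient (value mdp π) x.1‖ := by
        simpa using norm_add_le (x.2 - gradient (value mdp π) x.1) (gradient (value mdp π) x.1)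
      have h3 := mul_le_mul_of_nonneg_left h2 (show 0 ≤ η * G by positivity)
      rw [hnd]
      linarith
    obtain ⟨C, hJ, hC⟩ : ∃ C : ℝ, (∫ τ, ‖gpomdpOff mdp π τ θ' θ' - gpomdpOff mdp π τ θ' x.1‖ ^ 2
          ∂trajLaw mdp π θ' ≤ (η * ‖x.2‖) ^ 2 * C) ∧ (1 - p) * (η ^ 2 * C) ≤ p * B / 2 := by
      -- At p = 2/3 one has 1 − p = p/2. For larger p the condition η²·4L² ≤ 1 alone gives (1 −
      -- p)η²·4L² ≤ p/2, so the weaker smoothness constant is affordable. For smaller p the noise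
      -- condition is used with C ≥ 2L²; C_ω matters only through its sign.
      rcases le_or_gt p (2 / 3) with hp | hp
      · refine ⟨2 * L ^ 2, ?_, ?_⟩
        · rw [← hnd]
          refine integral_norm_gpomdpOff_sub_sq_le_two mdp hM hG hG0.le hM0.le θ' x.1 ?_
          -- 0.854² exceeds 2/3 + 1/16, and 0.854 + 1/4 = 1.104.
          refine (hdist 0.854 (by norm_num) (by linarith)).trans (le_of_eq ?_)
          rw [← had]
          norm_num
        · have h1 := hη_noise (by linarith)
          have hCω : 0 < constCω mdp.rmax mdp.discount G M W := by
            have := mdp.discount_pos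
            rw [constCω, ← had]
            positivity
          have hq : 0 < 1 - p := by linarith
          have hBr : (0 : ℝ) < B := by positivity
          have hCc : constC mdp.rmax mdp.discount G M W =
            2 * (L ^ 2 + constCω mdp.rmax mdp.discount G M W) := rfl
          rw [hCc, div_mul_div_comm, le_div_iff₀ (by positivity)] at h1
          have h2 : 0 ≤ η ^ 2 * (1 - p) * constCω mdp.rmax mdp.discount G M W := by positivity
          linarith
      · refine ⟨4 * L ^ 2, ?_, ?_⟩
        · rw [← hnd]
          refine integral_norm_gpomdpOff_sub_sq_le_four mdp hM hG hG0.le hM0.le θ' x.1 ?_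
          -- 1.031² exceeds 1 + 1/16, and 1.031 + 1/4 = 1.281.
          refine (hdist 1.031 (by norm_num) (by linarith)).trans (le_of_eq ?_)
          rw [← had]
          norm_num
        · rw [le_div_iff₀ (by positivity)] at hη_smooth
          have hB1 : (1 : ℝ) ≤ B := by exact_mod_cast hB
          nlinarith [mul_le_mul_of_nonneg_left hη_smooth (sub_nonneg.mpr hp1)]
    have hdesc := le_of_lipschitz_gradient (f := value mdp π) (L := L)
      (fun θ => by
        rw [gradient_value mdp hM hG hG0.le θ θ]
        exact hasGradientAt_value mdp hM hG hG0.le θ θ)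
      (fun θ₀ θ₁ => (norm_gradient_value_sub_le mdp hM hG hG0.le hM0.le θ₀ θ₁).trans
        (mul_le_mul_of_nonneg_right (lipBound_le_constL mdp hM0.le) (norm_nonneg _)))
      x.1 (η • x.2)
    rw [norm_smul, Real.norm_of_nonneg hη.le, inner_smul_right, ← hθ'] at hdesc
    refine potential_step_arith (I := inner ℝ (gradient (value mdp π) x.1) x.2) (L := L) hη hp0 hp1
      (by positivity) (by linarith) ?_ hJ hηL hC
    rw [norm_sub_sq_real, real_inner_comm]
  -- Above the level K: the small batch is bounded by K, the large batch by 2R/a plus its variance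
  -- term, and p(K − 2R/a) = (η/2)(RG/a²)² dominates (η/2)‖∇V‖².
  · rw [show potential mdp π β K x = _ from min_eq_right hcase]
    have h1 : p * (optValue mdp π - value mdp π θ' + β * (σ ^ 2 / N)) ≤
        p * (2 * mdp.rmax / a) + η * (σ ^ 2 / N) / 2 := by
      have h2 : p * (β * (σ ^ 2 / N)) = η * (σ ^ 2 / N) / 2 := by
        rw [hβd]
        field_simp
      have h3 := mul_le_mul_of_nonneg_left (optValue_sub_value_le mdp π θ') hp0.le
      rw [mul_add, h2]
      linarith
    refine (add_le_add h1 (mul_le_mul_of_nonneg_left (min_le_right _ _) (by linarith))).trans ?_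
    have h4 : p * K = p * (2 * mdp.rmax / a) + η / 2 * (mdp.rmax * G / a ^ 2) ^ 2 := by
      rw [hKeq, hβd]
      field_simp
    have h5 : ‖gradient (value mdp π) x.1‖ ^ 2 ≤ (mdp.rmax * G / a ^ 2) ^ 2 :=
      pow_le_pow_left₀ (norm_nonneg _) hgrad 2
    have h6 := mul_le_mul_of_nonneg_left h5 (show 0 ≤ η / 2 by positivity)
    linarith

end PagePG

/-! ### Summation of the drift and the final bound -/

open PagePG in
theorem corollary2 {d : ℕ} {S A : Type*} [MeasurableSpace S] [MeasurableSpace A]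
    (ν : Measure A) [SigmaFinite ν] (mdp : EpisodicMDP S A) (π : PolicyClass d S A ν)
    (G M σ W : ℝ) (hG : 0 < G) (hM : 0 < M) (hσ : 0 < σ) (hW : 0 < W)
    (h_score : PagePG.BoundedScore π G)
    (h_smooth : PagePG.SmoothPolicy π M)
    (h_var : PagePG.FiniteVariance mdp π σ)
    (h_weight : PagePG.FiniteWeightVariance mdp π W)
    (N B T : ℕ) (hN : 0 < N) (hB : 0 < B) (hT : 0 < T)
    (η p : ℝ) (hη : 0 < η) (hp0 : 0 < p) (hp1 : p ≤ 1)
    (hη_noise : p < 1 → η ^ 2 ≤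
      p / (1 - p) * ((B : ℝ) / (2 * PagePG.constC mdp.rmax mdp.discount G M W)))
    (hη_smooth : η ^ 2 ≤ 1 / (4 * PagePG.constL mdp.rmax mdp.discount G M ^ 2))
    (θ₀ : EuclideanSpace ℝ (Fin d))
    (Θ : Set (EuclideanSpace ℝ (Fin d)))
    (hΘ : ∀ t < T, ∀ᵐ x ∂(PagePG.iterLaw mdp π N B η p θ₀ t), x.1 ∈ Θ)
    (lam : ℝ) (hlam : 0 < lam) (h_dom : PagePG.GradientDominatedOn mdp π Θ lam) :
    (∀ t ≤ T, IsProbabilityMeasure (PagePG.iterLaw mdp π N B η p θ₀ t) ∧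
      Integrable (fun x => PagePG.value mdp π x.1) (PagePG.iterLaw mdp π N B η p θ₀ t)) ∧
    PagePG.optValue mdp π -
        (Finset.range (T + 1)).sup' ⟨0, Finset.mem_range.mpr (Nat.succ_pos T)⟩
          (fun t => ∫ x, PagePG.value mdp π x.1 ∂(PagePG.iterLaw mdp π N B η p θ₀ t)) ≤
      2 * lam * (PagePG.optValue mdp π - PagePG.value mdp π θ₀) / (η * T) +
        σ ^ 2 * lam / N + σ ^ 2 * lam / (p * N * T) := by
  have hiter := isProbabilityMeasure_iterLaw mdp h_smooth N B η hp0.le hp1 θ₀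
  have hVc := continuous_value mdp h_smooth h_score hG.le
  have hgc := continuous_gradient_value mdp h_smooth h_score hG.le hM.le
  have hVint : ∀ t, Integrable (fun x => value mdp π x.1) (iterLaw mdp π N B η p θ₀ t) := fun t =>
    Integrable.of_bound (hVc.measurable.comp measurable_fst).aestronglyMeasurable _
      (Filter.Eventually.of_forall fun x => abs_value_le mdp π x.1)
  refine ⟨fun t _ => ⟨hiter t, hVint t⟩, ?_⟩
  have hgint : ∀ t, Integrable (fun x => ‖gradient (value mdp π) x.1‖ ^ 2)
      (iterLaw mdp π N B η p θ₀ t) := fun t =>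
    Integrable.of_bound ((hgc.measurable.comp measurable_fst).norm.pow_const 2).aestronglyMeasurable
      (gradBound mdp G ^ 2) (Filter.Eventually.of_forall fun x => by
        rw [Real.norm_of_nonneg (sq_nonneg _)]
        exact pow_le_pow_left₀ (norm_nonneg _)
          (norm_gradient_value_le mdp h_smooth h_score hG.le x.1) 2)
  set w : ℕ → ℝ := fun t => ∫ x, value mdp π x.1 ∂iterLaw mdp π N B η p θ₀ t with hw
  set g : ℕ → ℝ := fun t => ∫ x, ‖gradient (value mdp π) x.1‖ ^ 2 ∂iterLaw mdp π N B η p θ₀ t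
    with hg
  set u : ℕ → ℝ := fun t => ∫ x, potential mdp π (η / (2 * p)) (truncLevel mdp G η p) x
    ∂iterLaw mdp π N B η p θ₀ t with hu
  have hβ : 0 ≤ η / (2 * p) := by positivity
  have hK : 0 ≤ truncLevel mdp G η p := by
    have := mdp.rmax_pos
    have : 0 < 1 - mdp.discount := by linarith [mdp.discount_lt_one]
    unfold truncLevel
    positivity
  have hpint : ∀ t, Integrable (potential mdp π (η / (2 * p)) (truncLevel mdp G η p))
      (iterLaw mdp π N B η p θ₀ t) := fun t =>
    integrable_potential mdp h_smooth h_score hG.le hM.le hβ hK _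
  have hu0 : u 0 ≤ optValue mdp π - value mdp π θ₀ + η / (2 * p) * (σ ^ 2 / N) :=
    integral_potential_largeBatch_le mdp h_smooth h_score hG.le hM.le h_var hβ hK hN θ₀
  have hupos : ∀ t, 0 ≤ u t := fun t => integral_nonneg fun x => potential_nonneg mdp π hβ hK x
  have hstep : ∀ t, u (t + 1) ≤ u t - η / 2 * g t + η * (σ ^ 2 / N) / 2 := by
    intro t
    have hint : Integrable (fun x => potential mdp π (η / (2 * p)) (truncLevel mdp G η p) x -
        η / 2 * ‖gradient (value mdp π) x.1‖ ^ 2) (iterLaw mdp π N B η p θ₀ t) :=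
      (hpint t).sub ((hgint t).const_mul _)
    calc u (t + 1) = ∫ x, ∫ y, potential mdp π (η / (2 * p)) (truncLevel mdp G η p) y
            ∂stepLaw mdp π N B η p x ∂iterLaw mdp π N B η p θ₀ t :=
          integral_iterLaw_succ mdp h_smooth N B η p θ₀ t (hpint (t + 1))
      _ ≤ ∫ x, (potential mdp π (η / (2 * p)) (truncLevel mdp G η p) x -
            η / 2 * ‖gradient (value mdp π) x.1‖ ^ 2 + η * (σ ^ 2 / N) / 2)
            ∂iterLaw mdp π N B η p θ₀ t :=
          integral_mono_of_nonneg
            (Filter.Eventually.of_forall fun x => integral_nonneg fun y =>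
              potential_nonneg mdp π hβ hK y)
            (hint.add (integrable_const _))
            (Filter.Eventually.of_forall fun x => integral_potential_stepLaw_le mdp h_smooth
              h_score hG hM hW h_var hN hB hη hp0 hp1 hη_noise hη_smooth x)
      _ = _ := by
          rw [integral_add hint (integrable_const _),
            integral_sub (hpint t) ((hgint t).const_mul _), integral_const_mul]
          simp [hu, hg]
  have hsum : ∀ n : ℕ, u n + η / 2 * ∑ t ∈ Finset.range n, g t ≤
      u 0 + n * (η * (σ ^ 2 / N) / 2) := by
    intro n
    induction n with
    | zero => simp
    | succ n ih =>
      rw [Finset.sum_range_succ]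
      push_cast
      linarith [hstep n]
  set m := (Finset.range (T + 1)).sup' ⟨0, Finset.mem_range.mpr (Nat.succ_pos T)⟩ w with hm
  -- Dominance is used only at t < T, where the iterates lie in Θ almost surely; enlarging the
  -- maximum to t = T only helps.
  have hgap : ∀ t ∈ Finset.range T, optValue mdp π - m ≤ lam * g t := by
    intro t ht
    have htT := Finset.mem_range.mp ht
    have h1 : w t ≤ m := Finset.le_sup' w (Finset.mem_range.mpr (by omega))
    have h2 : optValue mdp π - w t ≤ lam * g t := by
      calc optValue mdp π - w t = ∫ x, (optValue mdp π - value mdp π x.1)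
            ∂iterLaw mdp π N B η p θ₀ t := by
            rw [integral_sub (integrable_const _) (hVint t)]
            simp [hw]
        _ ≤ ∫ x, lam * ‖gradient (value mdp π) x.1‖ ^ 2 ∂iterLaw mdp π N B η p θ₀ t :=
            integral_mono_ae ((integrable_const _).sub (hVint t)) ((hgint t).const_mul _)
              ((hΘ t htT).mono fun x hx => h_dom x.1 hx)
        _ = _ := integral_const_mul _ _
    linarith
  have hTsum : T * (optValue mdp π - m) ≤ lam * ∑ t ∈ Finset.range T, g t := by
    have h1 := Finset.sum_le_sum hgap
    rw [Finset.sum_const, Finset.card_range, nsmul_eq_mul, ← Finset.mul_sum] at h1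
    exact h1
  have hT0 : (0 : ℝ) < T := by positivity
  have hN0 : (0 : ℝ) < N := by positivity
  -- The nonnegative u T is dropped. After multiplication by 2/η the initial error term becomes
  -- σ²/(pN), and the accumulated noise Tσ²/N.
  have hG2 : ∑ t ∈ Finset.range T, g t ≤ 2 / η * (optValue mdp π - value mdp π θ₀ +
      η / (2 * p) * (σ ^ 2 / N) + T * (η * (σ ^ 2 / N) / 2)) := by
    have h1 : η / 2 * ∑ t ∈ Finset.range T, g t ≤ optValue mdp π - value mdp π θ₀ +
      η / (2 * p) * (σ ^ 2 / N) + T * (η * (σ ^ 2 / N) / 2) := by linarith [hsum T, hupos T]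
    have h2 := mul_le_mul_of_nonneg_left h1 (show 0 ≤ 2 / η by positivity)
    refine le_trans (le_of_eq ?_) h2
    field_simp
  have hfin : T * (optValue mdp π - m) ≤ T * (2 * lam * (optValue mdp π - value mdp π θ₀) /
      (η * T) +
      σ ^ 2 * lam / N + σ ^ 2 * lam / (p * N * T)) := by
    refine (hTsum.trans (mul_le_mul_of_nonneg_left hG2 hlam.le)).trans (le_of_eq ?_)
    field_simp
    ring
  exact le_of_mul_le_mul_left hfin hT0
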